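/- Let $d,m\in\mathbb N$, $a,b>0$, $T>0$, $x_0\in\mathbb R^d$ and $C_L\in\mathbb R$ be given. Then there are constants $\bar C_1,\bar C_2>0$, depending only on $a,b,d,m,T,x_0$ and $C_L$, such that the following holds. Let $\mu:\mathbb R^d\to\mathbb R^d$ be twice differentiable and let $\sigma:\mathbb R^d\to\mathbb R^{d\times m}$ be such that for all $x,y\in\mathbb R^d$ $$|\nabla\mu(x)|^2\vee|\nabla^2\mu(x)|^2\le a,\qquad |\mu(x)-\mu(y)|^2\le a|x-y|^2,\qquad |\sigma(x)-\sigma(y)|^2\le b|x-y|^2,$$ $$|\mu(x)|^2\le a(1+|x|^2),\qquad |\sigma(x)|^2\le b(1+|x|^2),$$ where $|\cdot|$ is the Euclidean norm on vectors and the operator norm on matrices and derivatives (so that bounds in the Frobenius norm suffice). Let $f:\mathbb R^d\to\mathbb R$ be twice continuously differentiable with $\|\partial f/\partial x_i\|_\infty\le C_L$ and $\|\partial^2 f/\partial x_i\partial x_j\|_\infty\le C_L$ for all $i,j$. Let $\varepsilon\in(0,1)$, let $M\ge2$ and $\ell\ge1$ be integers, and set $h_k=T M^{-k}$ for $k \geq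 0$. Let $W$ be an $m$-dimensional standard Wiener process relative to a filtration on a probability space. Let $D_{h_\ell}$ and $D_{h_{\ell-1}}$ be the Euler–Maruyama approximations of the small-noise SDE $dD=\mu(D)\,dt+\varepsilon\,\sigma(D)\,dW$, $D(0)=x_0$, with step sizes $h=h_\ell$ and $h=h_{\ell-1}$, driven by this same $W$; that is, for each of these two values of $h$ and for every $t\ge0$, almost surely $$D_h(t)=x_0+\int_0^t\mu\bigl(D_h(\eta_h(s))\bigr)\,ds+\varepsilon\int_0^t\sigma\bigl(D_h(\eta_h(s))\bigr)\,dW(s),\qquad \eta_h(s)=\lfloor s/h\rfloor h .$$ Then, with $t_n=n\,h_{\ell-1}$, the random variables $f(D_{h_\ell}(t_n))-f(D_{h_{\ell-1}}(t_n))$, $0\le n\le M^{\ell-1}$, are square integrable and $$\max_{0\le n\le M^{\ell-1}}\mathrm{Var}\bigl(f(D_{h_\ell}(t_n))-f(D_{h_{\ell-1}}(t_n))\bigr)\le \bar C_1h_{\ell-1}^2\varepsilon^2+\bar C_2h_{\ell-1}\varepsilon^4 .$$ -/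

import Mathlib

open MeasureTheory ProbabilityTheory
open scoped NNReal

noncomputable section

namespace SmallNoise

/-- `W` is an `m`-dimensional standard Wiener process relative to the filtration `𝓕`: it is adapted,
its components are independent standard real Brownian motions, and for `s ≤ t` the increment
`W t - W s` is independent of `𝓕 s`. -/
structure IsWienerProcess {Ω : Type*} {mΩ : MeasurableSpace Ω} (P : Measure Ω)
    (𝓕 : Filtration ℝ≥0 mΩ) {m : ℕ} (W : ℝ≥0 → Ω → EuclideanSpace ℝ (Fin m)) : Prop where
  adapted : Adapted 𝓕 W
  isBrownian : ∀ j : Fin m, IsBrownianReal (fun t ω => W t ω j) P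
  indep_components : iIndepFun (fun (j : Fin m) (ω : Ω) (t : ℝ≥0) => W t ω j) P
  indep_increments : ∀ s t : ℝ≥0, s ≤ t →
    Indep (MeasurableSpace.comap (fun ω => W t ω - W s ω) inferInstance) (𝓕 s) P

/-- The standing assumptions on the drift `μ : ℝᵈ → ℝᵈ` and on the diffusion coefficient
`σ : ℝᵈ → ℝ^{d×m}` (matrices being identified with linear maps `ℝᵐ → ℝᵈ`). Vectors carry the
Euclidean norm; matrices and derivatives carry the operator norm, which is at most the
Frobenius norm. -/
structure RunningAssumption {d m : ℕ} (a b : ℝ)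
    (μ : EuclideanSpace ℝ (Fin d) → EuclideanSpace ℝ (Fin d))
    (σ : EuclideanSpace ℝ (Fin d) → (EuclideanSpace ℝ (Fin m) →L[ℝ] EuclideanSpace ℝ (Fin d))) :
    Prop where
  differentiable : Differentiable ℝ μ
  differentiable_fderiv : Differentiable ℝ (fderiv ℝ μ)
  norm_fderiv_sq_le : ∀ x, ‖fderiv ℝ μ x‖ ^ 2 ≤ a
  norm_fderiv_fderiv_sq_le : ∀ x, ‖fderiv ℝ (fderiv ℝ μ) x‖ ^ 2 ≤ a
  drift_lipschitz : ∀ x y, ‖μ x - μ y‖ ^ 2 ≤ a * ‖x - y‖ ^ 2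
  diffusion_lipschitz : ∀ x y, ‖σ x - σ y‖ ^ 2 ≤ b * ‖x - y‖ ^ 2
  drift_growth : ∀ x, ‖μ x‖ ^ 2 ≤ a * (1 + ‖x‖ ^ 2)
  diffusion_growth : ∀ x, ‖σ x‖ ^ 2 ≤ b * (1 + ‖x‖ ^ 2)

/-- `f : ℝᵈ → ℝ` is twice continuously differentiable, and all its first and second partial
derivatives are bounded by `C` in absolute value. -/
structure BoundedPartials {d : ℕ} (C : ℝ) (f : EuclideanSpace ℝ (Fin d) → ℝ) : Prop where
  contDiff : ContDiff ℝ 2 f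
  first : ∀ i x, |fderiv ℝ f x (EuclideanSpace.single i 1)| ≤ C
  second : ∀ i j x, |fderiv ℝ (fderiv ℝ f) x (EuclideanSpace.single i 1)
    (EuclideanSpace.single j 1)| ≤ C

/-- `η_h(s) = ⌊s / h⌋ h`, the last grid point of the grid `{0, h, 2h, …}` before `s`. -/
def gridFloor (h s : ℝ≥0) : ℝ≥0 := (⌊s / h⌋₊ : ℝ≥0) * h

/-- The Itô integral `∫₀ᵗ H(η_h(s)) dW(s)` of the step process equal to `H (k h)` on
`[k h, (k + 1) h)`, namely `∑ₖ H(k h) (W(min ((k+1) h) t) - W(min (k h) t))`, where the terms with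
`k > ⌊t / h⌋` vanish and are left out. -/
def stepItoIntegral {Ω : Type*} {d m : ℕ} (h : ℝ≥0)
    (H : ℝ≥0 → Ω → (EuclideanSpace ℝ (Fin m) →L[ℝ] EuclideanSpace ℝ (Fin d)))
    (W : ℝ≥0 → Ω → EuclideanSpace ℝ (Fin m)) (t : ℝ≥0) (ω : Ω) : EuclideanSpace ℝ (Fin d) :=
  ∑ k ∈ Finset.range (⌊t / h⌋₊ + 1),
    H ((k : ℝ≥0) * h) ω (W (min (((k : ℝ≥0) + 1) * h) t) ω - W (min ((k : ℝ≥0) * h) t) ω)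

/-- `D` is the (continuous-time) Euler–Maruyama approximation with step `h`, started at `x₀`:
for every `t ≥ 0`, almost surely
`D(t) = x₀ + ∫₀ᵗ μ(D(η_h(s))) ds + ε ∫₀ᵗ σ(D(η_h(s))) dW(s)`. -/
def IsEulerMaruyama {Ω : Type*} {mΩ : MeasurableSpace Ω} (P : Measure Ω) {d m : ℕ}
    (μ : EuclideanSpace ℝ (Fin d) → EuclideanSpace ℝ (Fin d))
    (σ : EuclideanSpace ℝ (Fin d) → (EuclideanSpace ℝ (Fin m) →L[ℝ] EuclideanSpace ℝ (Fin d)))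
    (ε : ℝ) (x₀ : EuclideanSpace ℝ (Fin d)) (W : ℝ≥0 → Ω → EuclideanSpace ℝ (Fin m))
    (h : ℝ≥0) (D : ℝ≥0 → Ω → EuclideanSpace ℝ (Fin d)) : Prop :=
  ∀ t : ℝ≥0, ∀ᵐ ω ∂P, D t ω =
    x₀ + (∫ s in (0 : ℝ)..t, μ (D (gridFloor h s.toNNReal) ω))
      + ε • stepItoIntegral h (fun s ω => σ (D s ω)) W t ω

/-- The step size `h_ℓ = T M^{-ℓ}`. -/
def stepSize (T : ℝ≥0) (M ℓ : ℕ) : ℝ≥0 := T / (M : ℝ≥0) ^ ℓ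

end SmallNoise

end

/-! The variance is at most the mean square distance to any constant, so `f(X) - f(Y)`, with `X` the
fine and `Y` the coarse scheme, may be compared with the deterministic number `f(z) - f(w)`, where
`z` and `w` are the same two schemes run with `ε = 0`. A four-point inequality
(`norm_four_point_le`) bounds the double difference by `L‖e‖ + L₂‖z - w‖‖Y - w‖`, where `e = X - z -
Y + w`. Let `H = M h` be the coarse step. Gronwall gives `‖z - w‖ = O(H)` and `E‖Y - w‖² = O(ε²)`,
so the second term contributes `H²ε²`. It remains to prove `E‖e‖² = O(H²ε² + Hε⁴)`, which is
`IsDiffusiveNoise.coupling_error_le`.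

Both schemes live on the fine grid once the coarse one is read as an Euler scheme whose coefficients
are frozen on blocks of `M` steps (`blockEuler`). Let `ΔU` be the noise accumulated since the start
of the current block, of mean square `O(H)`. Up to `e` and smaller terms, the diffusion difference
has size `H + ε‖ΔU‖`; multiplied by the noise amplitude `ε` it yields `H²ε² + Hε⁴`.

The drift difference is the delicate part. Its linear term `ε ∇μ(w) σ(w) ΔU` has mean square of
order `Hε²`, which is too large if treated as drift. Its coefficient is deterministic and constant
on each block, so exchanging the order of summation (`sum_block_increments`) turns its sum into a
martingale transform with coefficients `O(H)`, which costs only `H²ε²`. What is left of the drift,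
apart from a multiple of `e`, is a sum of products of two small quantities
(`CoefficientBounds.norm_drift_remainder_le`). A discrete Itô isometry
(`IsDiffusiveNoise.transform`) and Gronwall's inequality close the estimate. -/

noncomputable section

namespace SmallNoise

/-! ### Discrete Gronwall inequalities. -/

section Gronwall

/-- The delay `κ` accommodates coefficients frozen at the start of a block. It is harmless because
the majorant `α (1 + β) ^ i` is increasing in `i`. -/
theorem discrete_gronwall {u : ℕ → ℝ} {κ : ℕ → ℕ} (hκ : ∀ i, κ i ≤ i) {α β : ℝ} (hα : 0 ≤ α)
    (hβ : 0 ≤ β) {N : ℕ} (h : ∀ n ≤ N, u n ≤ α + β * ∑ i ∈ Finset.range n, u (κ i)) :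
    ∀ n ≤ N, u n ≤ α * (1 + β) ^ n := by
  intro n
  induction n using Nat.strong_induction_on with
  | _ n ih =>
    intro hn
    have hsum : ∑ i ∈ Finset.range n, u (κ i) ≤ ∑ i ∈ Finset.range n, α * (1 + β) ^ i := by
      refine Finset.sum_le_sum fun i hi => ?_
      have hi' := Finset.mem_range.1 hi
      refine (ih (κ i) ((hκ i).trans_lt hi') (((hκ i).trans hi'.le).trans hn)).trans ?_
      exact mul_le_mul_of_nonneg_left (pow_le_pow_right₀ (by linarith) (hκ i)) hα
    have hgeom : β * ∑ i ∈ Finset.range n, α * (1 + β) ^ i = α * (1 + β) ^ n - α := by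
      have := mul_geom_sum (1 + β) n
      rw [← Finset.mul_sum]
      linear_combination α * this
    have := mul_le_mul_of_nonneg_left hsum hβ
    linarith [h n hn]

theorem discrete_gronwall_exp {u : ℕ → ℝ} {κ : ℕ → ℕ} (hκ : ∀ i, κ i ≤ i) {α C h T : ℝ}
    (hα : 0 ≤ α) (hC : 0 ≤ C) (hh : 0 ≤ h) {N : ℕ} (hT : N * h ≤ T)
    (hu : ∀ n ≤ N, u n ≤ α + h * C * ∑ i ∈ Finset.range n, u (κ i)) :
    ∀ n ≤ N, u n ≤ α * Real.exp (C * T) := by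
  intro n hn
  refine (discrete_gronwall hκ hα (mul_nonneg hh hC) hu n hn).trans ?_
  refine mul_le_mul_of_nonneg_left ?_ hα
  have h1 : (1 + h * C) ^ n ≤ Real.exp (h * C) ^ n := by
    refine pow_le_pow_left₀ (by positivity) ?_ n
    linarith [Real.add_one_le_exp (h * C)]
  refine h1.trans ?_
  rw [← Real.exp_nat_mul]
  refine Real.exp_le_exp.2 ?_
  have h2 : (n : ℝ) * h ≤ T :=
    (mul_le_mul_of_nonneg_right (by exact_mod_cast hn) hh).trans hT
  nlinarith

end Gronwall

/-! ### First- and second-order difference estimates. -/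

section SecondOrder

variable {E F : Type*} [NormedAddCommGroup E] [NormedSpace ℝ E] [NormedAddCommGroup F]
  [NormedSpace ℝ F] {g : E → F} {L L₂ : ℝ}

theorem norm_sub_le_of_norm_fderiv_le (hd : Differentiable ℝ g) (hL : ∀ x, ‖fderiv ℝ g x‖ ≤ L)
    (x y : E) : ‖g x - g y‖ ≤ L * ‖x - y‖ :=
  convex_univ.norm_image_sub_le_of_norm_fderiv_le (fun x _ => hd x) (fun x _ => hL x)
    (Set.mem_univ y) (Set.mem_univ x)

/-- Mean value inequality for `x ↦ g (x + q) - g x` between `w` and `w + p`; its derivative is at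
most `L₂ ‖q‖`. -/
theorem norm_parallelogram_le (hd : Differentiable ℝ g)
    (hL₂ : ∀ x y, ‖fderiv ℝ g x - fderiv ℝ g y‖ ≤ L₂ * ‖x - y‖) (w p q : E) :
    ‖g (w + p + q) - g (w + p) - g (w + q) + g w‖ ≤ L₂ * ‖q‖ * ‖p‖ := by
  have hG : ∀ x, HasFDerivAt (fun x => g (x + q) - g x) (fderiv ℝ g (x + q) - fderiv ℝ g x) x :=
    fun x => ((hasFDerivAt_comp_add_right q).2 (hd (x + q)).hasFDerivAt).sub (hd x).hasFDerivAt
  have := convex_univ.norm_image_sub_le_of_norm_hasFDerivWithin_le (𝕜 := ℝ)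
    (fun x _ => (hG x).hasFDerivWithinAt)
    (fun x _ => (hL₂ (x + q) x).trans_eq (by rw [add_sub_cancel_left]))
    (Set.mem_univ w) (Set.mem_univ (w + p))
  rw [add_sub_cancel_left] at this
  refine le_trans (le_of_eq ?_) this
  congr 1
  abel

theorem norm_four_point_le (hd : Differentiable ℝ g) (hL : ∀ x, ‖fderiv ℝ g x‖ ≤ L)
    (hL₂ : ∀ x y, ‖fderiv ℝ g x - fderiv ℝ g y‖ ≤ L₂ * ‖x - y‖) (x y z w : E) :
    ‖g x - g y - g z + g w‖ ≤ L * ‖x - y - z + w‖ + L₂ * ‖z - w‖ * ‖y - w‖ := by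
  -- The point `y + (z - w)` completes `w`, `y`, `z` to a parallelogram; its distance to `x` is
  -- exactly the norm of the double difference.
  have h1 := norm_sub_le_of_norm_fderiv_le hd hL x (y + (z - w))
  have h2 := norm_parallelogram_le hd hL₂ w (y - w) (z - w)
  rw [add_sub_cancel, add_sub_cancel] at h2
  calc ‖g x - g y - g z + g w‖
      = ‖(g x - g (y + (z - w))) + (g (y + (z - w)) - g y - g z + g w)‖ := by congr 1; abel
    _ ≤ _ := norm_add_le _ _
    _ ≤ _ := add_le_add (h1.trans_eq (by congr 2; abel)) h2

/-- Taylor estimate with the derivative taken at a base point `p` other than `x`. This allows the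
linear term in the drift to have a deterministic coefficient. -/
theorem norm_sub_sub_fderiv_le (hd : Differentiable ℝ g) (h₀ : 0 ≤ L₂)
    (hL₂ : ∀ x y, ‖fderiv ℝ g x - fderiv ℝ g y‖ ≤ L₂ * ‖x - y‖) (x p v : E) :
    ‖g (x + v) - g x - fderiv ℝ g p v‖ ≤ L₂ * (‖x - p‖ + ‖v‖) * ‖v‖ := by
  have := (convex_closedBall x ‖v‖).norm_image_sub_le_of_norm_hasFDerivWithin_le' (𝕜 := ℝ)
    (f := g) (φ := fderiv ℝ g p) (C := L₂ * (‖x - p‖ + ‖v‖))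
    (fun y _ => (hd y).hasFDerivAt.hasFDerivWithinAt) (fun y hy => ?_)
    (Metric.mem_closedBall_self (norm_nonneg _)) (y := x + v) (by simp)
  · simpa using this
  · refine (hL₂ y p).trans (mul_le_mul_of_nonneg_left ?_ h₀)
    have h3 : ‖y - x‖ ≤ ‖v‖ := by simpa [dist_eq_norm] using hy
    calc ‖y - p‖ = ‖(x - p) + (y - x)‖ := by congr 1; abel
      _ ≤ ‖x - p‖ + ‖y - x‖ := norm_add_le _ _
      _ ≤ _ := by gcongr

end SecondOrder

/-! ### The Euler scheme with frozen coefficients and its noise-free version. -/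

section Scheme

variable {E V : Type*} [NormedAddCommGroup E] [NormedSpace ℝ E] [NormedAddCommGroup V]
  [NormedSpace ℝ V]

/-- Drift and diffusion coefficients whose Lipschitz constants, linear growth constants and
first-derivative Lipschitz constant (for the drift) are all at most `Λ`. -/
structure CoefficientBounds (Λ : ℝ) (μ : E → E) (σ : E → V →L[ℝ] E) : Prop where
  one_le : 1 ≤ Λ
  differentiable : Differentiable ℝ μ
  norm_fderiv_le : ∀ x, ‖fderiv ℝ μ x‖ ≤ Λ
  norm_fderiv_sub_le : ∀ x y, ‖fderiv ℝ μ x - fderiv ℝ μ y‖ ≤ Λ * ‖x - y‖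
  drift_lip : ∀ x y, ‖μ x - μ y‖ ≤ Λ * ‖x - y‖
  diffusion_lip : ∀ x y, ‖σ x - σ y‖ ≤ Λ * ‖x - y‖
  drift_growth : ∀ x, ‖μ x‖ ≤ Λ * (1 + ‖x‖)
  diffusion_growth : ∀ x, ‖σ x‖ ≤ Λ * (1 + ‖x‖)

/-- The Euler scheme with step `h` driven by the path `U`, in which the coefficients are frozen on
blocks of `M` consecutive steps. -/
def blockEuler (μ : E → E) (σ : E → V →L[ℝ] E) (ε h : ℝ) (x₀ : E) (M : ℕ) (U : ℕ → V) : ℕ → E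
  | 0 => x₀
  | k + 1 => blockEuler μ σ ε h x₀ M U k + h • μ (blockEuler μ σ ε h x₀ M U (k / M * M))
      + ε • σ (blockEuler μ σ ε h x₀ M U (k / M * M)) (U (k + 1) - U k)
decreasing_by
  · exact Nat.lt_succ_self _
  · exact Nat.lt_succ_of_le (Nat.div_mul_le_self _ _)

variable {μ : E → E} {σ : E → V →L[ℝ] E} {ε h : ℝ} {x₀ : E} {M : ℕ} {U : ℕ → V}

theorem blockEuler_zero : blockEuler μ σ ε h x₀ M U 0 = x₀ := by
  unfold blockEuler; rfl

theorem blockEuler_succ (k : ℕ) : blockEuler μ σ ε h x₀ M U (k + 1) =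
    blockEuler μ σ ε h x₀ M U k + h • μ (blockEuler μ σ ε h x₀ M U (k / M * M))
      + ε • σ (blockEuler μ σ ε h x₀ M U (k / M * M)) (U (k + 1) - U k) := by
  conv_lhs => unfold blockEuler

theorem blockEuler_eq_sum (n : ℕ) : blockEuler μ σ ε h x₀ M U n =
    x₀ + ∑ i ∈ Finset.range n, h • μ (blockEuler μ σ ε h x₀ M U (i / M * M))
      + ε • ∑ i ∈ Finset.range n,
        σ (blockEuler μ σ ε h x₀ M U (i / M * M)) (U (i + 1) - U i) := by
  induction n with
  | zero => simp [blockEuler_zero]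
  | succ n ih =>
    rw [blockEuler_succ, Finset.sum_range_succ, Finset.sum_range_succ, smul_add]
    nth_rewrite 1 [ih]
    abel

/-- Inside a block the coefficients do not change, so the steps add up to one Euler step. The case
`j = M` is included. -/
theorem blockEuler_block (hM : 0 < M) (q : ℕ) {j : ℕ} (hj : j ≤ M) :
    blockEuler μ σ ε h x₀ M U (q * M + j) = blockEuler μ σ ε h x₀ M U (q * M)
      + (j * h) • μ (blockEuler μ σ ε h x₀ M U (q * M))
      + ε • σ (blockEuler μ σ ε h x₀ M U (q * M)) (U (q * M + j) - U (q * M)) := by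
  induction j with
  | zero => simp
  | succ j ih =>
    have hq : (q * M + j) / M = q := by
      rw [mul_comm, Nat.mul_add_div hM, Nat.div_eq_of_lt (by omega), add_zero]
    rw [← add_assoc, blockEuler_succ, hq]
    nth_rewrite 1 [ih (by omega)]
    simp only [map_sub, smul_sub]
    push_cast
    module

theorem blockEuler_eq_anchor (hM : 0 < M) (k : ℕ) :
    blockEuler μ σ ε h x₀ M U k = blockEuler μ σ ε h x₀ M U (k / M * M)
      + (((k % M : ℕ) : ℝ) * h) • μ (blockEuler μ σ ε h x₀ M U (k / M * M))
      + ε • σ (blockEuler μ σ ε h x₀ M U (k / M * M)) (U k - U (k / M * M)) := by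
  have := blockEuler_block (μ := μ) (σ := σ) (ε := ε) (h := h) (x₀ := x₀) (U := U) hM (k / M)
    (Nat.mod_lt k hM).le
  rwa [Nat.div_add_mod'] at this

theorem CoefficientBounds.nonneg {Λ : ℝ} (hc : CoefficientBounds Λ μ σ) : 0 ≤ Λ :=
  zero_le_one.trans hc.one_le

/-- A bound for the noise-free Euler scheme on a time interval of length `T`. -/
def noiseFreeBound (Λ T r : ℝ) : ℝ := (r + T * Λ) * Real.exp (Λ * T)

theorem norm_blockEuler_zero_noise_le {Λ T : ℝ} (hc : CoefficientBounds Λ μ σ) (hh : 0 ≤ h)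
    {N : ℕ} (hT : N * h ≤ T) : ∀ n ≤ N,
    ‖blockEuler μ σ 0 h x₀ M U n‖ ≤ noiseFreeBound Λ T ‖x₀‖ := by
  have hΛ := hc.nonneg
  have hT0 : 0 ≤ T := le_trans (by positivity) hT
  refine discrete_gronwall_exp (κ := fun i => i / M * M) (fun i => Nat.div_mul_le_self i M)
    (by positivity) hΛ hh hT fun n hn => ?_
  rw [blockEuler_eq_sum, zero_smul, add_zero]
  have hnT : n * h ≤ T := (mul_le_mul_of_nonneg_right (by exact_mod_cast hn) hh).trans hT
  have h1 : ∑ i ∈ Finset.range n, ‖h • μ (blockEuler μ σ 0 h x₀ M U (i / M * M))‖ ≤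
      ∑ i ∈ Finset.range n, h * (Λ * (1 + ‖blockEuler μ σ 0 h x₀ M U (i / M * M)‖)) := by
    refine Finset.sum_le_sum fun i _ => ?_
    rw [norm_smul, Real.norm_of_nonneg hh]
    exact mul_le_mul_of_nonneg_left (hc.drift_growth _) hh
  have h2 : ∑ i ∈ Finset.range n, h * (Λ * (1 + ‖blockEuler μ σ 0 h x₀ M U (i / M * M)‖)) =
      n * h * Λ + h * Λ * ∑ i ∈ Finset.range n, ‖blockEuler μ σ 0 h x₀ M U (i / M * M)‖ := by
    rw [← Finset.mul_sum, ← Finset.mul_sum, Finset.sum_add_distrib]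
    simp
    ring
  calc _ ≤ ‖x₀‖ + ‖∑ i ∈ Finset.range n, h • μ (blockEuler μ σ 0 h x₀ M U (i / M * M))‖ :=
        norm_add_le _ _
    _ ≤ ‖x₀‖ + (n * h * Λ + h * Λ * ∑ i ∈ Finset.range n,
        ‖blockEuler μ σ 0 h x₀ M U (i / M * M)‖) := by
        gcongr
        exact (norm_sum_le _ _).trans (h1.trans_eq h2)
    _ ≤ _ := by
        have := mul_le_mul_of_nonneg_right hnT hΛ
        linarith

/-- A bound for the drift and for the diffusion coefficient along the noise-free Euler scheme. -/
def noiseFreeSpeed (Λ T r : ℝ) : ℝ := Λ * (1 + noiseFreeBound Λ T r)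

theorem noiseFreeBound_nonneg {Λ T r : ℝ} (hΛ : 0 ≤ Λ) (hT : 0 ≤ T) (hr : 0 ≤ r) :
    0 ≤ noiseFreeBound Λ T r := by unfold noiseFreeBound; positivity

theorem noiseFreeSpeed_nonneg {Λ T r : ℝ} (hΛ : 0 ≤ Λ) (hT : 0 ≤ T) (hr : 0 ≤ r) :
    0 ≤ noiseFreeSpeed Λ T r := by
  have := noiseFreeBound_nonneg hΛ hT hr
  unfold noiseFreeSpeed; positivity

theorem norm_blockEuler_sub_anchor_le {Λ T : ℝ} (hc : CoefficientBounds Λ μ σ) (hM : 0 < M)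
    (hh : 0 ≤ h) {N : ℕ} (hT : N * h ≤ T) {n : ℕ} (hn : n ≤ N) :
    ‖blockEuler μ σ 0 h x₀ M U n - blockEuler μ σ 0 h x₀ M U (n / M * M)‖ ≤
      noiseFreeSpeed Λ T ‖x₀‖ * (M * h) := by
  have hΛ := hc.nonneg
  nth_rewrite 1 [blockEuler_eq_anchor hM n]
  rw [zero_smul, add_zero, add_sub_cancel_left, norm_smul, Real.norm_of_nonneg (by positivity),
    mul_comm]
  have hb := norm_blockEuler_zero_noise_le (x₀ := x₀) (M := M) (U := U) hc hh hT _
    ((Nat.div_mul_le_self n M).trans hn)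
  refine mul_le_mul ((hc.drift_growth _).trans ?_) ?_ (by positivity) ?_
  · unfold noiseFreeSpeed; gcongr
  · gcongr; exact_mod_cast (Nat.mod_lt n hM).le
  · exact noiseFreeSpeed_nonneg hΛ (le_trans (by positivity) hT) (norm_nonneg _)

/-- The constant in the bound for the distance of two noise-free Euler schemes. -/
def noiseFreeGap (Λ T r : ℝ) : ℝ := T * Λ * noiseFreeSpeed Λ T r * Real.exp (Λ * T)

theorem noiseFreeGap_nonneg {Λ T r : ℝ} (hΛ : 0 ≤ Λ) (hT : 0 ≤ T) (hr : 0 ≤ r) :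
    0 ≤ noiseFreeGap Λ T r := by
  have := noiseFreeSpeed_nonneg hΛ hT hr
  unfold noiseFreeGap; positivity

/-- First-order convergence of the deterministic Euler method: freezing the drift over a block costs
its Lipschitz constant times the distance travelled since the block began. -/
theorem norm_blockEuler_one_sub_le {Λ T : ℝ} (hc : CoefficientBounds Λ μ σ) (hM : 0 < M)
    (hh : 0 ≤ h) {N : ℕ} (hT : N * h ≤ T) : ∀ n ≤ N,
    ‖blockEuler μ σ 0 h x₀ 1 U n - blockEuler μ σ 0 h x₀ M U n‖ ≤
      noiseFreeGap Λ T ‖x₀‖ * (M * h) := by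
  have hΛ := hc.nonneg
  have hT0 : 0 ≤ T := le_trans (by positivity) hT
  set ρ := noiseFreeSpeed Λ T ‖x₀‖ with hρ
  have hρ0 : 0 ≤ ρ := noiseFreeSpeed_nonneg hΛ hT0 (norm_nonneg _)
  have key := discrete_gronwall_exp (κ := fun i => i)
    (u := fun n => ‖blockEuler μ σ 0 h x₀ 1 U n - blockEuler μ σ 0 h x₀ M U n‖)
    (α := T * Λ * ρ * (M * h)) (fun i => le_rfl) (by positivity) hΛ hh hT fun n hn => ?_
  · intro n hn
    refine (key n hn).trans_eq ?_
    unfold noiseFreeGap; ring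
  have hnT : n * h ≤ T := (mul_le_mul_of_nonneg_right (by exact_mod_cast hn) hh).trans hT
  rw [blockEuler_eq_sum, blockEuler_eq_sum, zero_smul, zero_smul, add_zero, add_zero,
    add_sub_add_left_eq_sub, ← Finset.sum_sub_distrib]
  have h1 : ∀ i ∈ Finset.range n, ‖h • μ (blockEuler μ σ 0 h x₀ 1 U (i / 1 * 1))
      - h • μ (blockEuler μ σ 0 h x₀ M U (i / M * M))‖ ≤
      h * (Λ * (‖blockEuler μ σ 0 h x₀ 1 U i - blockEuler μ σ 0 h x₀ M U i‖ + ρ * (M * h))) := by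
    intro i hi
    rw [← smul_sub, norm_smul, Real.norm_of_nonneg hh, Nat.div_one, mul_one]
    refine mul_le_mul_of_nonneg_left ((hc.drift_lip _ _).trans ?_) hh
    gcongr
    have := norm_blockEuler_sub_anchor_le (x₀ := x₀) (U := U) hc hM hh hT
      ((Finset.mem_range.1 hi).le.trans hn)
    refine (norm_sub_le_norm_sub_add_norm_sub _ (blockEuler μ σ 0 h x₀ M U i) _).trans ?_
    gcongr
  refine (norm_sum_le_of_le _ h1).trans ?_
  rw [← Finset.mul_sum, ← Finset.mul_sum, Finset.sum_add_distrib]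
  simp only [Finset.sum_const, Finset.card_range, nsmul_eq_mul]
  have := mul_le_mul_of_nonneg_right hnT (by positivity : 0 ≤ Λ * (ρ * (M * h)))
  nlinarith

end Scheme

/-! ### Regrouping sums of increments over blocks. -/

section Regrouping

variable {E V : Type*} [NormedAddCommGroup E] [NormedSpace ℝ E] [NormedAddCommGroup V]
  [NormedSpace ℝ V]

/-- Telescoping inside each block. In the induction, passing from `n` to `n + 1` changes only the
block of index `n / M`: earlier blocks are complete and later ones are still empty. -/
theorem sum_blocks_eq_sum_steps {M : ℕ} (hM : 0 < M) (G : ℕ → V →L[ℝ] E) (U : ℕ → V) {N : ℕ}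
    (n : ℕ) (hn : n / M < N) :
    ∑ k ∈ Finset.range N, G k (U (min ((k + 1) * M) n) - U (min (k * M) n)) =
      ∑ i ∈ Finset.range n, G (i / M) (U (i + 1) - U i) := by
  induction n with
  | zero => simp
  | succ n ih =>
    have hn' : n / M < N := (Nat.div_le_div_right n.le_succ).trans_lt hn
    rw [Finset.sum_range_succ, ← ih hn']
    have hstep : ∀ k ∈ Finset.range N,
        G k (U (min ((k + 1) * M) (n + 1)) - U (min (k * M) (n + 1))) =
          G k (U (min ((k + 1) * M) n) - U (min (k * M) n)) +
            if k = n / M then G k (U (n + 1) - U n) else 0 := by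
      intro k _
      rcases lt_trichotomy k (n / M) with hk | hk | hk
      · have h1 : (k + 1) * M ≤ n := (Nat.le_div_iff_mul_le hM).1 hk
        have h2 : k * M ≤ n := (Nat.mul_le_mul_right M k.le_succ).trans h1
        rw [min_eq_left h1, min_eq_left h2, min_eq_left (h1.trans n.le_succ),
          min_eq_left (h2.trans n.le_succ), if_neg hk.ne, add_zero]
      · have h1 : n + 1 ≤ (k + 1) * M := (Nat.div_lt_iff_lt_mul hM).1 (by omega)
        have h2 : k * M ≤ n := hk ▸ Nat.div_mul_le_self n M
        rw [min_eq_right h1, min_eq_left h2, min_eq_left (h2.trans n.le_succ),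
          min_eq_right (n.le_succ.trans h1), if_pos hk, ← map_add]
        congr 1; abel
      · have h2 : n + 1 ≤ k * M := (Nat.div_lt_iff_lt_mul hM).1 hk
        have h1 : n + 1 ≤ (k + 1) * M := h2.trans (Nat.mul_le_mul_right M k.le_succ)
        rw [min_eq_right h1, min_eq_right h2, min_eq_right (n.le_succ.trans h1),
          min_eq_right (n.le_succ.trans h2), if_neg hk.ne']
        simp
    rw [Finset.sum_congr rfl hstep, Finset.sum_add_distrib, Finset.sum_ite_eq',
      if_pos (Finset.mem_range.2 hn')]

/-- The number of indices `k < n` after `i` in the same block of length `M` as `i`. -/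
def laterInBlock (M n i : ℕ) : ℕ := {k ∈ Finset.range n | i < k ∧ i / M = k / M}.card

theorem laterInBlock_le {M : ℕ} (hM : 0 < M) (n i : ℕ) : laterInBlock M n i ≤ M := by
  have : {k ∈ Finset.range n | i < k ∧ i / M = k / M} ⊆
      Finset.Ico (i / M * M) (i / M * M + M) := by
    intro k hk
    simp only [Finset.mem_filter, Finset.mem_range] at hk
    rw [Finset.mem_Ico, hk.2.2]
    have := Nat.div_add_mod' k M
    have := Nat.mod_lt k hM
    omega
  simpa [laterInBlock] using Finset.card_le_card this

/-- Each `U k - U (k / M * M)` is a sum of single increments; after exchanging the sums, increment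
`i` is counted once for every later `k` in its block. The weight is at most `M`, so multiplication
by `h` gives a coefficient of at most the coarse step. -/
theorem sum_block_increments {M : ℕ} (hM : 0 < M) (G : ℕ → V →L[ℝ] E) (U : ℕ → V) (n : ℕ) :
    ∑ k ∈ Finset.range n, G (k / M) (U k - U (k / M * M)) =
      ∑ i ∈ Finset.range n, (laterInBlock M n i : ℝ) • G (i / M) (U (i + 1) - U i) := by
  have h1 : ∀ k ∈ Finset.range n, G (k / M) (U k - U (k / M * M)) =
      ∑ i ∈ Finset.range n, if i < k ∧ i / M = k / M then G (i / M) (U (i + 1) - U i) else 0 := by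
    intro k hk
    have hk' := Finset.mem_range.1 hk
    rw [← Finset.sum_Ico_sub U (Nat.div_mul_le_self k M), map_sum, ← Finset.sum_filter]
    have hset : {i ∈ Finset.range n | i < k ∧ i / M = k / M} = Finset.Ico (k / M * M) k := by
      ext i
      simp only [Finset.mem_filter, Finset.mem_range, Finset.mem_Ico]
      constructor
      · rintro ⟨_, h1, h2⟩
        exact ⟨h2 ▸ Nat.div_mul_le_self i M, h1⟩
      · rintro ⟨h1, h2⟩
        exact ⟨h2.trans hk', h2, le_antisymm (Nat.div_le_div_right h2.le)
          ((Nat.le_div_iff_mul_le hM).2 h1)⟩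
    rw [← hset]
    refine Finset.sum_congr rfl fun i hi => ?_
    rw [(Finset.mem_filter.1 hi).2.2]
  rw [Finset.sum_congr rfl h1, Finset.sum_comm]
  refine Finset.sum_congr rfl fun i _ => ?_
  rw [← Finset.sum_filter, Finset.sum_const, laterInBlock, Nat.cast_smul_eq_nsmul]

end Regrouping

/-! ### From the integral equation to the recursion on the fine grid. -/

section Reduction

theorem floor_div_natCast_mul {h : ℝ≥0} (M : ℕ) (s : ℝ≥0) :
    ⌊s / ((M : ℝ≥0) * h)⌋₊ = ⌊s / h⌋₊ / M := by
  rw [← Nat.floor_div_natCast, div_div, mul_comm h]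

variable {d m : ℕ}

theorem integral_gridFloor {E : Type*} [NormedAddCommGroup E] [NormedSpace ℝ E] [CompleteSpace E]
    {h : ℝ≥0} (hh : 0 < h) (M n : ℕ) (g : ℝ≥0 → E) :
    ∫ s in (0 : ℝ)..((n * h : ℝ≥0) : ℝ), g (gridFloor (M * h) s.toNNReal) =
      ∑ i ∈ Finset.range n, (h : ℝ) • g ((i / M * M : ℕ) * h) := by
  -- Open intervals suffice for the integral, and the right endpoint must be left out since
  -- `gridFloor` may jump there.
  have hcongr : ∀ i : ℕ, Set.EqOn (fun _ => g ((i / M * M : ℕ) * h))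
      (fun s : ℝ => g (gridFloor (M * h) s.toNNReal))
      (Set.uIoo ((i : ℝ) * h) (((i + 1 : ℕ) : ℝ) * h)) := by
    intro i s hs
    have hh' : (0 : ℝ) < h := hh
    rw [Set.uIoo_of_le (by gcongr; simp)] at hs
    have hfl : ⌊s.toNNReal / h⌋₊ = i := by
      rw [Nat.floor_eq_iff zero_le, le_div_iff₀ hh, div_lt_iff₀ hh]
      have hs0 : 0 ≤ s := le_trans (by positivity) hs.1.le
      constructor
      · rw [← NNReal.coe_le_coe, Real.coe_toNNReal _ hs0]
        exact_mod_cast hs.1.le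
      · rw [← NNReal.coe_lt_coe, Real.coe_toNNReal _ hs0]
        exact_mod_cast hs.2
    simp only [gridFloor, floor_div_natCast_mul, hfl]
    push_cast
    rw [mul_assoc]
  have hint := intervalIntegral.sum_integral_adjacent_intervals (μ := volume)
    (f := fun s : ℝ => g (gridFloor (M * h) s.toNNReal)) (a := fun i : ℕ => (i : ℝ) * h) (n := n)
    fun i _ => IntervalIntegrable.congr_uIoo intervalIntegrable_const (hcongr i)
  simp only [Nat.cast_zero, zero_mul] at hint
  rw [NNReal.coe_mul, NNReal.coe_natCast, ← hint]
  refine Finset.sum_congr rfl fun i _ => ?_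
  rw [← intervalIntegral.integral_congr_uIoo (hcongr i), intervalIntegral.integral_const]
  congr 1
  push_cast; ring

theorem stepItoIntegral_grid {Ω : Type*} {h : ℝ≥0} (hh : 0 < h) {M : ℕ} (hM : 0 < M) (n : ℕ)
    (H : ℝ≥0 → Ω → (EuclideanSpace ℝ (Fin m) →L[ℝ] EuclideanSpace ℝ (Fin d)))
    (W : ℝ≥0 → Ω → EuclideanSpace ℝ (Fin m)) (ω : Ω) :
    stepItoIntegral (M * h) H W (n * h) ω = ∑ i ∈ Finset.range n,
      H ((i / M * M : ℕ) * h) ω (W ((i + 1 : ℕ) * h) ω - W (i * h) ω) := by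
  have hmin : ∀ p q : ℕ, min ((p : ℝ≥0) * h) (q * h) = (min p q : ℕ) * h := fun p q => by
    rw [Nat.cast_min, min_mul_of_nonneg _ _ hh.le]
  have := sum_blocks_eq_sum_steps hM (fun k => H ((k * M : ℕ) * h) ω) (fun k => W (k * h) ω)
    (N := n / M + 1) n (Nat.lt_succ_self _)
  rw [← this, stepItoIntegral, floor_div_natCast_mul, mul_div_cancel_right₀ _ hh.ne',
    Nat.floor_natCast]
  refine Finset.sum_congr rfl fun k _ => ?_
  rw [← hmin, ← hmin]
  push_cast
  simp only [mul_assoc]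

theorem IsEulerMaruyama.ae_eq_blockEuler {Ω : Type*} {mΩ : MeasurableSpace Ω} {P : Measure Ω}
    {μ : EuclideanSpace ℝ (Fin d) → EuclideanSpace ℝ (Fin d)}
    {σ : EuclideanSpace ℝ (Fin d) → (EuclideanSpace ℝ (Fin m) →L[ℝ] EuclideanSpace ℝ (Fin d))}
    {ε : ℝ} {x₀ : EuclideanSpace ℝ (Fin d)} {W : ℝ≥0 → Ω → EuclideanSpace ℝ (Fin m)}
    {h : ℝ≥0} (hh : 0 < h) {M : ℕ} (hM : 0 < M) {D : ℝ≥0 → Ω → EuclideanSpace ℝ (Fin d)}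
    (hD : IsEulerMaruyama P μ σ ε x₀ W (M * h) D) :
    ∀ᵐ ω ∂P, ∀ n : ℕ, D (n * h) ω = blockEuler μ σ ε h x₀ M (fun k => W (k * h) ω) n := by
  -- The equation holds almost surely for each fixed time; the grid is countable, so one null set
  -- serves all grid times.
  filter_upwards [ae_all_iff.2 fun n : ℕ => hD (n * h)] with ω hω n
  induction n using Nat.strong_induction_on with
  | _ n ih =>
    rw [hω n, integral_gridFloor hh M n (fun s => μ (D s ω)), stepItoIntegral_grid hh hM,
      blockEuler_eq_sum]
    have hi : ∀ i ∈ Finset.range n, D ((i / M * M : ℕ) * h) ω =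
        blockEuler μ σ ε h x₀ M (fun k => W (k * h) ω) (i / M * M) := fun i hi =>
      ih _ ((Nat.div_mul_le_self i M).trans_lt (Finset.mem_range.1 hi))
    congr 1
    · congr 1
      exact Finset.sum_congr rfl fun i hi' => by rw [hi i hi']
    · congr 1
      exact Finset.sum_congr rfl fun i hi' => by rw [hi i hi']

end Reduction

/-! ### Pathwise bounds for the coupled drift and diffusion differences. -/

section Pointwise

variable {E V : Type*} [NormedAddCommGroup E] [NormedSpace ℝ E] [NormedAddCommGroup V]
  [NormedSpace ℝ V] {Λ : ℝ} {μ : E → E} {σ : E → V →L[ℝ] E}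

/-- In the application `y` and `w` are the coarse schemes with and without noise at the block start,
`y + δ + ν + v` and `w + δ` their current values, `δ` the noise-free displacement, `v` the leading
noise and `ν` the rest. The four-point inequality handles `x` and `z`, a Lipschitz bound removes
`ν`, a Taylor step at `w` extracts the linear term in `v`, and the parallelogram bound handles `δ`.
-/
theorem CoefficientBounds.norm_drift_remainder_le (hc : CoefficientBounds Λ μ σ)
    (x z y w δ ν v : E) :
    ‖μ x - μ z - μ y + μ w - fderiv ℝ μ w v‖ ≤
      Λ * ‖x - z - (y + δ + ν + v) + (w + δ)‖
        + Λ * ‖z - (w + δ)‖ * ‖y + δ + ν + v - (w + δ)‖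
        + Λ * ‖ν‖ + Λ * (‖y - w‖ + ‖δ‖ + ‖v‖) * ‖v‖ + Λ * ‖δ‖ * ‖y - w‖ := by
  have h1 := norm_four_point_le hc.differentiable hc.norm_fderiv_le hc.norm_fderiv_sub_le
    x (y + δ + ν + v) z (w + δ)
  have h2 := hc.drift_lip (y + δ + ν + v) (y + δ + v)
  have h3 := norm_sub_sub_fderiv_le hc.differentiable hc.nonneg hc.norm_fderiv_sub_le (y + δ) w v
  have h4 := norm_parallelogram_le hc.differentiable hc.norm_fderiv_sub_le w (y - w) δ
  rw [add_sub_cancel] at h4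
  have h5 : ‖y + δ - w‖ ≤ ‖y - w‖ + ‖δ‖ := by
    rw [add_sub_right_comm]; exact norm_add_le _ _
  rw [show y + δ + ν + v - (y + δ + v) = ν by abel] at h2
  rw [show x - (y + δ + ν + v) - z + (w + δ) = x - z - (y + δ + ν + v) + (w + δ) by abel] at h1
  have h3' : ‖μ (y + δ + v) - μ (y + δ) - fderiv ℝ μ w v‖ ≤
      Λ * (‖y - w‖ + ‖δ‖ + ‖v‖) * ‖v‖ := by
    refine h3.trans ?_
    have := hc.nonneg
    gcongr
  calc ‖μ x - μ z - μ y + μ w - fderiv ℝ μ w v‖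
      = ‖(μ x - μ (y + δ + ν + v) - μ z + μ (w + δ)) + (μ (y + δ + ν + v) - μ (y + δ + v))
        + (μ (y + δ + v) - μ (y + δ) - fderiv ℝ μ w v)
        + (μ (y + δ) - μ y - μ (w + δ) + μ w)‖ := by congr 1; abel
    _ ≤ _ := norm_add₄_le
    _ ≤ _ := by linarith

/-- The common constant in the pointwise bounds for the drift and diffusion differences. -/
def couplingConstant (Λ T r : ℝ) : ℝ :=
  Λ * (1 + noiseFreeGap Λ T r + Λ + noiseFreeSpeed Λ T r + noiseFreeSpeed Λ T r ^ 2)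

variable {ε h T : ℝ} {x₀ : E} {M N : ℕ} {U : ℕ → V}

/-- The displacement since the block start, split into the three parts `δ`, `ν`, `v` of
`CoefficientBounds.norm_drift_remainder_le`. -/
theorem blockEuler_eq_anchor_add (hM : 0 < M) (n : ℕ) :
    blockEuler μ σ ε h x₀ M U n = blockEuler μ σ ε h x₀ M U (n / M * M)
      + (blockEuler μ σ 0 h x₀ M U n - blockEuler μ σ 0 h x₀ M U (n / M * M))
      + ((((n % M : ℕ) : ℝ) * h) • (μ (blockEuler μ σ ε h x₀ M U (n / M * M))
            - μ (blockEuler μ σ 0 h x₀ M U (n / M * M)))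
          + ε • (σ (blockEuler μ σ ε h x₀ M U (n / M * M))
            - σ (blockEuler μ σ 0 h x₀ M U (n / M * M))) (U n - U (n / M * M)))
      + ε • σ (blockEuler μ σ 0 h x₀ M U (n / M * M)) (U n - U (n / M * M)) := by
  have h1 := blockEuler_eq_anchor (μ := μ) (σ := σ) (ε := ε) (h := h) (x₀ := x₀) (U := U) hM n
  have h0 := blockEuler_eq_anchor (μ := μ) (σ := σ) (ε := 0) (h := h) (x₀ := x₀) (U := U) hM n
  rw [h1, h0]
  simp only [sub_apply, smul_sub, zero_smul]
  abel

theorem CoefficientBounds.norm_anchor_deviation_le (hc : CoefficientBounds Λ μ σ) (hM : 0 < M)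
    (hh : 0 ≤ h) (hε : 0 ≤ ε) (n : ℕ) (y w : E) (v : V) :
    ‖(((n % M : ℕ) : ℝ) * h) • (μ y - μ w) + ε • (σ y - σ w) v‖ ≤
      Λ * (M * h * ‖y - w‖) + Λ * (ε * ‖y - w‖ * ‖v‖) := by
  have hΛ := hc.nonneg
  have hn : ((n % M : ℕ) : ℝ) ≤ M := by exact_mod_cast (Nat.mod_lt n hM).le
  refine (norm_add_le _ _).trans ?_
  rw [norm_smul, norm_smul, Real.norm_of_nonneg (by positivity), Real.norm_of_nonneg hε]
  have h1 : (n % M : ℕ) * h * ‖μ y - μ w‖ ≤ M * h * (Λ * ‖y - w‖) := by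
    gcongr; exact hc.drift_lip _ _
  have h2 : ε * ‖(σ y - σ w) v‖ ≤ ε * (Λ * ‖y - w‖ * ‖v‖) := by
    gcongr
    exact ((σ y - σ w).le_opNorm v).trans (by gcongr; exact hc.diffusion_lip _ _)
  linarith

theorem CoefficientBounds.norm_noise_at_anchor_le (hc : CoefficientBounds Λ μ σ) (hh : 0 ≤ h)
    (hε : 0 ≤ ε) (hT : N * h ≤ T) {n : ℕ} (hn : n ≤ N) (v : V) :
    ‖ε • σ (blockEuler μ σ 0 h x₀ M U (n / M * M)) v‖ ≤ noiseFreeSpeed Λ T ‖x₀‖ * (ε * ‖v‖) := by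
  have hΛ := hc.nonneg
  rw [norm_smul, Real.norm_of_nonneg hε]
  have hb := norm_blockEuler_zero_noise_le (x₀ := x₀) (M := M) (U := U) hc hh hT _
    ((Nat.div_mul_le_self n M).trans hn)
  have : ‖σ (blockEuler μ σ 0 h x₀ M U (n / M * M))‖ ≤ noiseFreeSpeed Λ T ‖x₀‖ :=
    (hc.diffusion_growth _).trans (by unfold noiseFreeSpeed; gcongr)
  have h2 := (σ (blockEuler μ σ 0 h x₀ M U (n / M * M))).le_of_opNorm_le this v
  nlinarith

/-- With the linear noise term subtracted, every summand other than the double difference is a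
product of two small factors. -/
theorem CoefficientBounds.norm_coupled_drift_le (hc : CoefficientBounds Λ μ σ) (hM : 0 < M)
    (hh : 0 ≤ h) (hε : 0 ≤ ε) (hT : N * h ≤ T) {n : ℕ} (hn : n ≤ N)
    {X z Y w : ℕ → E} (hY : Y = blockEuler μ σ ε h x₀ M U) (hz : z = blockEuler μ σ 0 h x₀ 1 U)
    (hw : w = blockEuler μ σ 0 h x₀ M U) :
    ‖μ (X n) - μ (z n) - μ (Y (n / M * M)) + μ (w (n / M * M))
        - ε • fderiv ℝ μ (w (n / M * M)) (σ (w (n / M * M)) (U n - U (n / M * M)))‖ ≤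
      couplingConstant Λ T ‖x₀‖ * (‖X n - z n - Y n + w n‖ + M * h * ‖Y n - w n‖
        + M * h * ‖Y (n / M * M) - w (n / M * M)‖
        + ε * ‖Y (n / M * M) - w (n / M * M)‖ * ‖U n - U (n / M * M)‖
        + ε * (M * h) * ‖U n - U (n / M * M)‖ + ε ^ 2 * ‖U n - U (n / M * M)‖ ^ 2) := by
  have hΛ := hc.nonneg
  have hT0 : 0 ≤ T := le_trans (by positivity) hT
  have hzw := norm_blockEuler_one_sub_le (x₀ := x₀) (U := U) hc hM hh hT n hn
  have hδ := norm_blockEuler_sub_anchor_le (x₀ := x₀) (U := U) hc hM hh hT hn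
  have hv := hc.norm_noise_at_anchor_le (x₀ := x₀) (M := M) (U := U) hh hε hT hn
    (U n - U (n / M * M))
  have hν := hc.norm_anchor_deviation_le hM hh hε n (Y (n / M * M)) (w (n / M * M))
    (U n - U (n / M * M))
  have hYn := blockEuler_eq_anchor_add (μ := μ) (σ := σ) (ε := ε) (h := h) (x₀ := x₀) (U := U)
    hM n
  rw [← hz, ← hw] at hzw
  rw [← hw] at hδ hv hYn
  rw [← hY] at hYn
  have hζ0 := noiseFreeGap_nonneg hΛ hT0 (norm_nonneg x₀)
  have hρ0 := noiseFreeSpeed_nonneg hΛ hT0 (norm_nonneg x₀)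
  have key := hc.norm_drift_remainder_le (X n) (z n) (Y (n / M * M)) (w (n / M * M))
    (w n - w (n / M * M))
    ((((n % M : ℕ) : ℝ) * h) • (μ (Y (n / M * M)) - μ (w (n / M * M)))
      + ε • (σ (Y (n / M * M)) - σ (w (n / M * M))) (U n - U (n / M * M)))
    (ε • σ (w (n / M * M)) (U n - U (n / M * M)))
  rw [← hYn, add_sub_cancel, map_smul] at key
  refine key.trans ?_
  unfold couplingConstant
  set ρ := noiseFreeSpeed Λ T ‖x₀‖
  set ζ := noiseFreeGap Λ T ‖x₀‖
  set e := ‖X n - z n - Y n + w n‖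
  set bn := ‖Y n - w n‖
  set b := ‖Y (n / M * M) - w (n / M * M)‖
  set u := ‖U n - U (n / M * M)‖
  have hH : 0 ≤ M * h := by positivity
  generalize M * h = H at *
  have he : 0 ≤ e := norm_nonneg _
  have hbn : 0 ≤ bn := norm_nonneg _
  have hb : 0 ≤ b := norm_nonneg _
  have hu : 0 ≤ u := norm_nonneg _
  calc _ ≤ Λ * e + Λ * (ζ * H) * bn + Λ * (Λ * (H * b) + Λ * (ε * b * u))
        + Λ * (b + ρ * H + ρ * (ε * u)) * (ρ * (ε * u)) + Λ * (ρ * H) * b := by gcongr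
    _ ≤ _ := by
      have h1 : 0 ≤ Λ * (ζ + Λ + ρ + ρ ^ 2) * e := by positivity
      have h2 : 0 ≤ Λ * (1 + Λ + ρ + ρ ^ 2) * (H * bn) := by positivity
      have h3 : 0 ≤ Λ * (1 + ζ + ρ ^ 2) * (H * b) := by positivity
      have h4 : 0 ≤ Λ * (1 + ζ + ρ ^ 2) * (ε * b * u) := by positivity
      have h5 : 0 ≤ Λ * (1 + ζ + Λ + ρ) * (ε * H * u) := by positivity
      have h6 : 0 ≤ Λ * (1 + ζ + Λ + ρ) * (ε ^ 2 * u ^ 2) := by positivity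
      linear_combination h1 + h2 + h3 + h4 + h5 + h6

/-- A first-order bound is enough here, since the diffusion enters with a further factor `ε`. The
bare terms `M * h` and `ε * ‖U n - U (n / M * M)‖` are the ones behind the two rates. -/
theorem CoefficientBounds.norm_coupled_diffusion_le (hc : CoefficientBounds Λ μ σ) (hM : 0 < M)
    (hh : 0 ≤ h) (hε : 0 ≤ ε) (hT : N * h ≤ T) {n : ℕ} (hn : n ≤ N)
    {X z Y w : ℕ → E} (hY : Y = blockEuler μ σ ε h x₀ M U) (hz : z = blockEuler μ σ 0 h x₀ 1 U)
    (hw : w = blockEuler μ σ 0 h x₀ M U) :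
    ‖σ (X n) - σ (Y (n / M * M))‖ ≤
      couplingConstant Λ T ‖x₀‖ * (‖X n - z n - Y n + w n‖ + M * h
        + M * h * ‖Y (n / M * M) - w (n / M * M)‖
        + ε * ‖Y (n / M * M) - w (n / M * M)‖ * ‖U n - U (n / M * M)‖
        + ε * ‖U n - U (n / M * M)‖) := by
  have hΛ := hc.nonneg
  have hT0 : 0 ≤ T := le_trans (by positivity) hT
  have hzw := norm_blockEuler_one_sub_le (x₀ := x₀) (U := U) hc hM hh hT n hn
  have hδ := norm_blockEuler_sub_anchor_le (x₀ := x₀) (U := U) hc hM hh hT hn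
  have hv := hc.norm_noise_at_anchor_le (x₀ := x₀) (M := M) (U := U) hh hε hT hn
    (U n - U (n / M * M))
  have hν := hc.norm_anchor_deviation_le hM hh hε n (Y (n / M * M)) (w (n / M * M))
    (U n - U (n / M * M))
  have hYn := blockEuler_eq_anchor_add (μ := μ) (σ := σ) (ε := ε) (h := h) (x₀ := x₀) (U := U)
    hM n
  rw [← hz, ← hw] at hzw
  rw [← hw] at hδ hv hYn
  rw [← hY] at hYn
  have hζ0 := noiseFreeGap_nonneg hΛ hT0 (norm_nonneg x₀)
  have hρ0 := noiseFreeSpeed_nonneg hΛ hT0 (norm_nonneg x₀)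
  have hX : X n - Y (n / M * M) = (X n - z n - Y n + w n) + (z n - w n) + (w n - w (n / M * M))
      + ((((n % M : ℕ) : ℝ) * h) • (μ (Y (n / M * M)) - μ (w (n / M * M)))
        + ε • (σ (Y (n / M * M)) - σ (w (n / M * M))) (U n - U (n / M * M)))
      + ε • σ (w (n / M * M)) (U n - U (n / M * M)) := by
    rw [eq_comm, ← sub_eq_zero] at hYn ⊢
    rw [← hYn]
    abel
  refine (hc.diffusion_lip _ _).trans ?_
  rw [hX]
  have htri := (norm_add_le ((X n - z n - Y n + w n) + (z n - w n) + (w n - w (n / M * M))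
      + ((((n % M : ℕ) : ℝ) * h) • (μ (Y (n / M * M)) - μ (w (n / M * M)))
        + ε • (σ (Y (n / M * M)) - σ (w (n / M * M))) (U n - U (n / M * M))))
      (ε • σ (w (n / M * M)) (U n - U (n / M * M)))).trans (add_le_add norm_add₄_le le_rfl)
  refine (mul_le_mul_of_nonneg_left htri hΛ).trans ?_
  unfold couplingConstant
  set ρ := noiseFreeSpeed Λ T ‖x₀‖
  set ζ := noiseFreeGap Λ T ‖x₀‖
  set e := ‖X n - z n - Y n + w n‖
  set b := ‖Y (n / M * M) - w (n / M * M)‖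
  set u := ‖U n - U (n / M * M)‖
  have hH : 0 ≤ M * h := by positivity
  generalize M * h = H at *
  have he : 0 ≤ e := norm_nonneg _
  have hb : 0 ≤ b := norm_nonneg _
  have hu : 0 ≤ u := norm_nonneg _
  calc _ ≤ Λ * (e + ζ * H + ρ * H + (Λ * (H * b) + Λ * (ε * b * u)) + ρ * (ε * u)) := by gcongr
    _ ≤ _ := by
      have h1 : 0 ≤ Λ * (ζ + Λ + ρ + ρ ^ 2) * e := by positivity
      have h2 : 0 ≤ Λ * (1 + Λ + ρ ^ 2) * H := by positivity
      have h3 : 0 ≤ Λ * (1 + ζ + ρ + ρ ^ 2) * (H * b) := by positivity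
      have h4 : 0 ≤ Λ * (1 + ζ + ρ + ρ ^ 2) * (ε * b * u) := by positivity
      have h5 : 0 ≤ Λ * (1 + ζ + Λ + ρ ^ 2) * (ε * u) := by positivity
      linear_combination h1 + h2 + h3 + h4 + h5

/-- The linear noise term is subtracted from the drift and, regrouped by `sum_block_increments`,
returned to the martingale part with weight `laterInBlock M n i * h`. -/
theorem sub_blockEuler_eq_sum (hM : 0 < M) {X z Y w : ℕ → E}
    (hX : X = blockEuler μ σ ε h x₀ 1 U)
    (hY : Y = blockEuler μ σ ε h x₀ M U) (hz : z = blockEuler μ σ 0 h x₀ 1 U)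
    (hw : w = blockEuler μ σ 0 h x₀ M U) (n : ℕ) :
    X n - z n - Y n + w n =
      h • ∑ i ∈ Finset.range n, (μ (X i) - μ (z i) - μ (Y (i / M * M)) + μ (w (i / M * M))
        - ε • fderiv ℝ μ (w (i / M * M)) (σ (w (i / M * M)) (U i - U (i / M * M))))
      + ε • ∑ i ∈ Finset.range n, (σ (X i) - σ (Y (i / M * M)) + (laterInBlock M n i * h) •
        (fderiv ℝ μ (w (i / M * M)) ∘L σ (w (i / M * M)))) (U (i + 1) - U i) := by
  have hreg := sum_block_increments hM
    (fun q => fderiv ℝ μ (w (q * M)) ∘L σ (w (q * M))) U n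
  have e1 := blockEuler_eq_sum (μ := μ) (σ := σ) (ε := ε) (h := h) (x₀ := x₀) (M := 1) (U := U) n
  have e2 := blockEuler_eq_sum (μ := μ) (σ := σ) (ε := ε) (h := h) (x₀ := x₀) (M := M) (U := U) n
  have e3 := blockEuler_eq_sum (μ := μ) (σ := σ) (ε := 0) (h := h) (x₀ := x₀) (M := 1) (U := U) n
  have e4 := blockEuler_eq_sum (μ := μ) (σ := σ) (ε := 0) (h := h) (x₀ := x₀) (M := M) (U := U) n
  rw [← hX] at e1
  rw [← hY] at e2
  rw [← hz] at e3
  rw [← hw] at e4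
  simp only [Nat.div_one, mul_one, zero_smul, add_zero, ← Finset.smul_sum] at e1 e2 e3 e4
  rw [e1, e2, e3, e4]
  simp only [Finset.sum_add_distrib, Finset.sum_sub_distrib, add_apply,
    sub_apply, smul_apply, ← Finset.smul_sum,
    mul_comm _ h, mul_smul]
  simp only [ContinuousLinearMap.comp_apply] at hreg ⊢
  rw [hreg]
  module

end Pointwise

/-! ### Discrete stochastic integration: isometry and energy estimate. -/

section Noise

variable {Ω : Type*} {mΩ : MeasurableSpace Ω} {m : ℕ}

/-- A discrete-time process adapted to `G` whose increments are centred, independent of the past and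
have second and fourth moments of the order of the elapsed time and of its square, where one time
step has length `h`. -/
structure IsDiffusiveNoise (P : Measure Ω) (G : Filtration ℕ mΩ) (c h : ℝ)
    (U : ℕ → Ω → EuclideanSpace ℝ (Fin m)) : Prop where
  const_nonneg : 0 ≤ c
  step_nonneg : 0 ≤ h
  adapted : ∀ i, StronglyMeasurable[G i] (U i)
  indep : ∀ i j, i ≤ j →
    Indep (MeasurableSpace.comap (fun ω => U j ω - U i ω) inferInstance) (G i) P
  memLp : ∀ i j, i ≤ j → MemLp (fun ω => U j ω - U i ω) 4 P
  mean : ∀ i j, i ≤ j → ∀ a, ∫ ω, (U j ω - U i ω) a ∂P = 0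
  second : ∀ i j, i ≤ j → ∫ ω, ‖U j ω - U i ω‖ ^ 2 ∂P ≤ c * ((j - i) * h)
  fourth : ∀ i j, i ≤ j → ∫ ω, ‖U j ω - U i ω‖ ^ 4 ∂P ≤ c * ((j - i) * h) ^ 2

variable {P : Measure Ω} [IsProbabilityMeasure P] {G : Filtration ℕ mΩ} {c h : ℝ}
  {U : ℕ → Ω → EuclideanSpace ℝ (Fin m)}

omit [IsProbabilityMeasure P] in
theorem integrable_inner_of_memLp_two {E : Type*} [NormedAddCommGroup E] [InnerProductSpace ℝ E]
    {X Y : Ω → E} (hX : MemLp X 2 P) (hY : MemLp Y 2 P) :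
    Integrable (fun ω => inner ℝ (X ω) (Y ω)) P :=
  (hX.norm.integrable_mul hY.norm).mono' (hX.aestronglyMeasurable.inner hY.aestronglyMeasurable)
    (ae_of_all _ fun _ => norm_inner_le_norm _ _)

namespace IsDiffusiveNoise

theorem memLp_two (hU : IsDiffusiveNoise P G c h U) {i j : ℕ} (hij : i ≤ j) :
    MemLp (fun ω => U j ω - U i ω) 2 P :=
  (hU.memLp i j hij).mono_exponent (by norm_num)

omit [IsProbabilityMeasure P] in
theorem indepFun (hU : IsDiffusiveNoise P G c h U) {i j : ℕ} (hij : i ≤ j)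
    {F : Type*} [TopologicalSpace F] [TopologicalSpace.PseudoMetrizableSpace F]
    [MeasurableSpace F] [BorelSpace F] {φ : Ω → F} (hφ : StronglyMeasurable[G i] φ) :
    IndepFun φ (fun ω => U j ω - U i ω) P := by
  rw [IndepFun_iff_Indep]
  exact indep_of_indep_of_le_left (hU.indep i j hij).symm (hφ.measurable.comap_le)

theorem memLp_mul_norm (hU : IsDiffusiveNoise P G c h U) {i j : ℕ} (hij : i ≤ j)
    {φ : Ω → ℝ} (hφ : StronglyMeasurable[G i] φ) (hφ2 : MemLp φ 2 P) :
    MemLp (fun ω => φ ω * ‖U j ω - U i ω‖) 2 P ∧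
      ∫ ω, (φ ω * ‖U j ω - U i ω‖) ^ 2 ∂P ≤ c * ((j - i) * h) * ∫ ω, φ ω ^ 2 ∂P := by
  have hΔ := hU.memLp_two hij
  have hind : IndepFun (fun ω => φ ω ^ 2) (fun ω => ‖U j ω - U i ω‖ ^ 2) P :=
    (hU.indepFun hij hφ).comp (φ := fun x : ℝ => x ^ 2)
      (ψ := fun v : EuclideanSpace ℝ (Fin m) => ‖v‖ ^ 2) (by fun_prop) (by fun_prop)
  have hi1 : Integrable (fun ω => φ ω ^ 2) P := hφ2.integrable_sq
  have hi2 : Integrable (fun ω => ‖U j ω - U i ω‖ ^ 2) P := hΔ.norm.integrable_sq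
  refine ⟨?_, ?_⟩
  · refine (memLp_two_iff_integrable_sq
      (hφ2.aestronglyMeasurable.mul hΔ.norm.aestronglyMeasurable)).2 ?_
    exact (hind.integrable_mul hi1 hi2).congr (ae_of_all _ fun ω => (mul_pow _ _ 2).symm)
  · simp only [mul_pow]
    rw [hind.integral_fun_mul_eq_mul_integral hi1.aestronglyMeasurable hi2.aestronglyMeasurable,
      mul_comm]
    exact mul_le_mul_of_nonneg_right (hU.second i j hij) (integral_nonneg fun _ => sq_nonneg _)

variable {E : Type*} [NormedAddCommGroup E] [InnerProductSpace ℝ E]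

theorem memLp_apply (hU : IsDiffusiveNoise P G c h U) {i j : ℕ} (hij : i ≤ j)
    {K : Ω → EuclideanSpace ℝ (Fin m) →L[ℝ] E} (hK : StronglyMeasurable[G i] K)
    (hK2 : MemLp K 2 P) :
    MemLp (fun ω => K ω (U j ω - U i ω)) 2 P ∧
      ∫ ω, ‖K ω (U j ω - U i ω)‖ ^ 2 ∂P ≤ c * ((j - i) * h) * ∫ ω, ‖K ω‖ ^ 2 ∂P := by
  obtain ⟨h1, h2⟩ := hU.memLp_mul_norm hij hK.norm hK2.norm
  have hle : ∀ ω, ‖K ω (U j ω - U i ω)‖ ≤ ‖K ω‖ * ‖U j ω - U i ω‖ := fun ω => (K ω).le_opNorm _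
  have hmeas : AEStronglyMeasurable (fun ω => K ω (U j ω - U i ω)) P :=
    isBoundedBilinearMap_apply.continuous.comp_aestronglyMeasurable
      (hK2.aestronglyMeasurable.prodMk (hU.memLp_two hij).aestronglyMeasurable)
  have hmem : MemLp (fun ω => K ω (U j ω - U i ω)) 2 P :=
    h1.mono' hmeas (ae_of_all _ hle)
  refine ⟨hmem, le_trans ?_ h2⟩
  exact integral_mono hmem.norm.integrable_sq h1.integrable_sq
    fun ω => pow_le_pow_left₀ (norm_nonneg _) (hle ω) 2

theorem integral_inner_apply (hU : IsDiffusiveNoise P G c h U) {i j : ℕ} (hij : i ≤ j)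
    {K : Ω → EuclideanSpace ℝ (Fin m) →L[ℝ] E} (hK : StronglyMeasurable[G i] K)
    (hK2 : MemLp K 2 P) {S : Ω → E} (hS : StronglyMeasurable[G i] S) (hS2 : MemLp S 2 P) :
    ∫ ω, inner ℝ (S ω) (K ω (U j ω - U i ω)) ∂P = 0 := by
  -- In coordinates each term is a real variable known at time `i` times a centred component of the
  -- increment, so independence applies to real products.
  have hexp : ∀ ω, inner ℝ (S ω) (K ω (U j ω - U i ω)) =
      ∑ a, inner ℝ (S ω) (K ω (EuclideanSpace.single a 1)) * (U j ω - U i ω) a := by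
    intro ω
    have : (U j ω - U i ω) = ∑ a, (U j ω - U i ω) a • EuclideanSpace.single a (1 : ℝ) := by
      have := (EuclideanSpace.basisFun (Fin m) ℝ).sum_repr (U j ω - U i ω)
      simpa using this.symm
    conv_lhs => rw [this, map_sum, inner_sum]
    refine Finset.sum_congr rfl fun a _ => ?_
    rw [map_smul, inner_smul_right, mul_comm]
  have hap : ∀ a : Fin m, StronglyMeasurable[G i]
      (fun ω => K ω (EuclideanSpace.single a 1)) := fun a =>
    (ContinuousLinearMap.apply ℝ E (EuclideanSpace.single a (1 : ℝ))).continuous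
      |>.comp_stronglyMeasurable hK
  have hap2 : ∀ a : Fin m, MemLp (fun ω => K ω (EuclideanSpace.single a 1)) 2 P := fun a =>
    (ContinuousLinearMap.apply ℝ E (EuclideanSpace.single a (1 : ℝ))).comp_memLp' hK2
  have hin : ∀ a : Fin m, StronglyMeasurable[G i]
      (fun ω => inner ℝ (S ω) (K ω (EuclideanSpace.single a 1))) := fun a => hS.inner (hap a)
  have hin1 : ∀ a : Fin m,
      Integrable (fun ω => inner ℝ (S ω) (K ω (EuclideanSpace.single a 1))) P := fun a =>
    integrable_inner_of_memLp_two hS2 (hap2 a)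
  have hco1 : ∀ a : Fin m, Integrable (fun ω => (U j ω - U i ω) a) P := fun a =>
    (EuclideanSpace.proj (𝕜 := ℝ) a).integrable_comp ((hU.memLp_two hij).integrable (by norm_num))
  have hind : ∀ a : Fin m, IndepFun (fun ω => inner ℝ (S ω) (K ω (EuclideanSpace.single a 1)))
      (fun ω => (U j ω - U i ω) a) P := fun a =>
    (hU.indepFun hij (hin a)).comp (φ := id) (ψ := fun v : EuclideanSpace ℝ (Fin m) => v a)
      measurable_id (by fun_prop)
  simp only [hexp]
  have hprod : ∀ a ∈ Finset.univ, Integrable (fun ω =>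
      inner ℝ (S ω) (K ω (EuclideanSpace.single a 1)) * (U j ω - U i ω) a) P :=
    fun a _ => (hind a).integrable_mul (hin1 a) (hco1 a)
  rw [integral_finsetSum _ hprod]
  refine Finset.sum_eq_zero fun a _ => ?_
  rw [(hind a).integral_fun_mul_eq_mul_integral (hin1 a).aestronglyMeasurable
    (hco1 a).aestronglyMeasurable, hU.mean i j hij a, mul_zero]

omit [IsProbabilityMeasure P] in
theorem stronglyMeasurable_apply (hU : IsDiffusiveNoise P G c h U) {i j : ℕ} (hij : i ≤ j)
    {K : Ω → EuclideanSpace ℝ (Fin m) →L[ℝ] E} (hK : StronglyMeasurable[G i] K) :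
    StronglyMeasurable[G j] (fun ω => K ω (U j ω - U i ω)) :=
  isBoundedBilinearMap_apply.continuous.comp_stronglyMeasurable
    ((hK.mono (G.mono hij)).prodMk ((hU.adapted j).sub ((hU.adapted i).mono (G.mono hij))))

/-- Itô isometry in inequality form: each new term is orthogonal to the preceding sum. -/
theorem transform (hU : IsDiffusiveNoise P G c h U)
    {K : ℕ → Ω → EuclideanSpace ℝ (Fin m) →L[ℝ] E} (n : ℕ)
    (hK : ∀ i < n, StronglyMeasurable[G i] (K i)) (hK2 : ∀ i < n, MemLp (K i) 2 P) :
    StronglyMeasurable[G n] (fun ω => ∑ i ∈ Finset.range n, K i ω (U (i + 1) ω - U i ω)) ∧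
    MemLp (fun ω => ∑ i ∈ Finset.range n, K i ω (U (i + 1) ω - U i ω)) 2 P ∧
      ∫ ω, ‖∑ i ∈ Finset.range n, K i ω (U (i + 1) ω - U i ω)‖ ^ 2 ∂P ≤
        c * h * ∑ i ∈ Finset.range n, ∫ ω, ‖K i ω‖ ^ 2 ∂P := by
  induction n with
  | zero => simp [stronglyMeasurable_const]
  | succ n ih =>
    obtain ⟨hm, hL, hb⟩ := ih (fun i hi => hK i (hi.trans n.lt_succ_self))
      (fun i hi => hK2 i (hi.trans n.lt_succ_self))
    have hKn := hK n n.lt_succ_self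
    have hKn2 := hK2 n n.lt_succ_self
    obtain ⟨ha, hab⟩ := hU.memLp_apply n.le_succ hKn hKn2
    have horth := hU.integral_inner_apply n.le_succ hKn hKn2 hm hL
    simp only [Finset.sum_range_succ]
    refine ⟨(hm.mono (G.mono n.le_succ)).add (hU.stronglyMeasurable_apply n.le_succ hKn),
      hL.add ha, ?_⟩
    simp only [norm_add_sq_real]
    have hii := (integrable_inner_of_memLp_two hL ha).const_mul 2
    have hsum := hL.norm.integrable_sq.add hii
    simp only [Pi.add_def] at hsum
    rw [integral_add hsum ha.norm.integrable_sq,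
      integral_add hL.norm.integrable_sq hii, integral_const_mul, horth, mul_zero, add_zero, mul_add]
    refine add_le_add hb (hab.trans_eq ?_)
    push_cast; ring

/-- The energy estimate for a discrete Itô process with drift `a` and diffusion `K`. -/
theorem energy (hU : IsDiffusiveNoise P G c h U) {T : ℝ} {n : ℕ} (hT : n * h ≤ T)
    {a : ℕ → Ω → E} {K : ℕ → Ω → EuclideanSpace ℝ (Fin m) →L[ℝ] E} (ε : ℝ)
    (ha : ∀ i < n, MemLp (a i) 2 P)
    (hK : ∀ i < n, StronglyMeasurable[G i] (K i)) (hK2 : ∀ i < n, MemLp (K i) 2 P) :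
    ∫ ω, ‖h • ∑ i ∈ Finset.range n, a i ω
        + ε • ∑ i ∈ Finset.range n, K i ω (U (i + 1) ω - U i ω)‖ ^ 2 ∂P ≤
      2 * T * h * ∑ i ∈ Finset.range n, ∫ ω, ‖a i ω‖ ^ 2 ∂P
        + 2 * ε ^ 2 * c * h * ∑ i ∈ Finset.range n, ∫ ω, ‖K i ω‖ ^ 2 ∂P := by
  obtain ⟨-, hL, hb⟩ := hU.transform n hK hK2
  have hh := hU.step_nonneg
  have hA : MemLp (fun ω => ∑ i ∈ Finset.range n, a i ω) 2 P :=
    memLp_finsetSum _ fun i hi => ha i (Finset.mem_range.1 hi)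
  have hai : ∀ i ∈ Finset.range n, Integrable (fun ω => ‖a i ω‖ ^ 2) P := fun i hi =>
    (ha i (Finset.mem_range.1 hi)).norm.integrable_sq
  have hpt : ∀ ω, ‖h • ∑ i ∈ Finset.range n, a i ω
        + ε • ∑ i ∈ Finset.range n, K i ω (U (i + 1) ω - U i ω)‖ ^ 2 ≤
      2 * T * h * ∑ i ∈ Finset.range n, ‖a i ω‖ ^ 2
        + 2 * ε ^ 2 * ‖∑ i ∈ Finset.range n, K i ω (U (i + 1) ω - U i ω)‖ ^ 2 := by
    intro ω
    -- Cauchy–Schwarz; the factor `n` is absorbed through `n * h ≤ T`.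
    have h1 : ‖∑ i ∈ Finset.range n, a i ω‖ ^ 2 ≤ n * ∑ i ∈ Finset.range n, ‖a i ω‖ ^ 2 := by
      refine (pow_le_pow_left₀ (norm_nonneg _) (norm_sum_le _ _) 2).trans ?_
      simpa using sq_sum_le_card_mul_sum_sq (s := Finset.range n) (f := fun i => ‖a i ω‖)
    have h0 : 0 ≤ ∑ i ∈ Finset.range n, ‖a i ω‖ ^ 2 := Finset.sum_nonneg fun _ _ => sq_nonneg _
    have h2 : h ^ 2 * ‖∑ i ∈ Finset.range n, a i ω‖ ^ 2 ≤
        T * h * ∑ i ∈ Finset.range n, ‖a i ω‖ ^ 2 := by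
      calc _ ≤ h ^ 2 * (n * ∑ i ∈ Finset.range n, ‖a i ω‖ ^ 2) := by gcongr
        _ = (n * h) * h * ∑ i ∈ Finset.range n, ‖a i ω‖ ^ 2 := by ring
        _ ≤ _ := by gcongr
    refine (pow_le_pow_left₀ (norm_nonneg _) (norm_add_le _ _) 2).trans (add_sq_le.trans ?_)
    rw [norm_smul, norm_smul, mul_pow, mul_pow, Real.norm_eq_abs, Real.norm_eq_abs, sq_abs, sq_abs]
    linarith
  calc _ ≤ ∫ ω, (2 * T * h * ∑ i ∈ Finset.range n, ‖a i ω‖ ^ 2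
        + 2 * ε ^ 2 * ‖∑ i ∈ Finset.range n, K i ω (U (i + 1) ω - U i ω)‖ ^ 2) ∂P :=
        integral_mono ((hA.const_smul h).add (hL.const_smul ε)).norm.integrable_sq
          (((integrable_finsetSum _ hai).const_mul _).add (hL.norm.integrable_sq.const_mul _)) hpt
    _ = 2 * T * h * ∑ i ∈ Finset.range n, ∫ ω, ‖a i ω‖ ^ 2 ∂P
        + 2 * ε ^ 2 * ∫ ω, ‖∑ i ∈ Finset.range n, K i ω (U (i + 1) ω - U i ω)‖ ^ 2 ∂P := by
        rw [integral_add ((integrable_finsetSum _ hai).const_mul _)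
          (hL.norm.integrable_sq.const_mul _), integral_const_mul, integral_const_mul,
          integral_finsetSum _ hai]
    _ ≤ _ := by
        have := mul_le_mul_of_nonneg_left hb (by positivity : 0 ≤ 2 * ε ^ 2)
        linarith

end IsDiffusiveNoise

end Noise

/-! ### A Wiener process sampled on a grid is a diffusive noise. -/

section Brownian

variable {Ω : Type*} {mΩ : MeasurableSpace Ω} {m : ℕ}

/-- The fourth moment of the standard Gaussian distribution. -/
def gaussianFourthMoment : ℝ := ∫ x, x ^ 4 ∂(gaussianReal 0 1)

theorem gaussianFourthMoment_nonneg : 0 ≤ gaussianFourthMoment :=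
  integral_nonneg fun x => by positivity

theorem integral_pow_four_gaussianReal (v : ℝ≥0) :
    ∫ x, x ^ 4 ∂(gaussianReal 0 v) = v ^ 2 * gaussianFourthMoment := by
  have h : (gaussianReal 0 1).map (fun x => √v * x) = gaussianReal 0 v := by
    rw [gaussianReal_map_const_mul]
    congr 1
    · simp
    · ext; simp
  rw [← h, integral_map (by fun_prop) (by fun_prop), gaussianFourthMoment, ← integral_const_mul]
  congr 1; ext x
  rw [mul_pow, show √(v : ℝ) ^ 4 = (√(v : ℝ) ^ 2) ^ 2 by ring, Real.sq_sqrt v.coe_nonneg]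

/-- The moment constant for the increments of an `m`-dimensional Wiener process. -/
def wienerConstant (m : ℕ) : ℝ := m + m ^ 2 * gaussianFourthMoment

theorem IsWienerProcess.isDiffusiveNoise {P : Measure Ω} [IsProbabilityMeasure P]
    {𝓕 : Filtration ℝ≥0 mΩ} {W : ℝ≥0 → Ω → EuclideanSpace ℝ (Fin m)}
    (hW : IsWienerProcess P 𝓕 W) (h : ℝ≥0) :
    IsDiffusiveNoise P
      (⟨fun k : ℕ => 𝓕 (k * h), fun i j hij => 𝓕.mono (by gcongr), fun k => 𝓕.le _⟩ :
        Filtration ℕ mΩ) (wienerConstant m) h (fun k => W (k * h)) := by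
  have hc4 := gaussianFourthMoment_nonneg
  have hlaw : ∀ (i j : ℕ), i ≤ j → ∀ a, HasLaw (fun ω => (W (j * h) ω - W (i * h) ω) a)
      (gaussianReal 0 ((j - i : ℕ) * h)) P := by
    intro i j hij a
    have := (hW.isBrownian a).toIsPreBrownianReal.hasLaw_sub (j * h) (i * h)
    have hv : nndist ((j * h : ℝ≥0) : ℝ) ((i * h : ℝ≥0) : ℝ) = (j - i : ℕ) * h := by
      refine NNReal.eq ?_
      rw [coe_nndist, Real.dist_eq]
      simp only [NNReal.coe_mul, NNReal.coe_natCast]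
      have : (i : ℝ) ≤ j := by exact_mod_cast hij
      rw [Nat.cast_sub hij, ← sub_mul, abs_of_nonneg (mul_nonneg (by linarith) h.coe_nonneg)]
    rw [← hv]
    exact this
  have hmem : ∀ (i j : ℕ), i ≤ j → ∀ a,
      MemLp (fun ω => (W (j * h) ω - W (i * h) ω) a) 4 P := by
    intro i j hij a
    have h1 := memLp_id_gaussianReal (μ := 0) (v := ((j - i : ℕ) * h)) 4
    rw [← (hlaw i j hij a).map_eq] at h1
    exact h1.comp_of_map (hlaw i j hij a).aemeasurable
  have hmemV : ∀ (i j : ℕ), i ≤ j → MemLp (fun ω => W (j * h) ω - W (i * h) ω) 4 P := by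
    intro i j hij
    refine MemLp.of_eval_piLp fun a => hmem i j hij a
  have hint4 : ∀ (i j : ℕ), i ≤ j → ∀ a,
      Integrable (fun ω => ((W (j * h) ω - W (i * h) ω) a) ^ 4) P := by
    intro i j hij a
    have := (hmem i j hij a).integrable_norm_pow (p := 4) (by norm_num)
    refine this.congr (ae_of_all _ fun ω => ?_)
    simp only [Real.norm_eq_abs]
    exact Even.pow_abs (by decide) _
  have hint2 : ∀ (i j : ℕ), i ≤ j → ∀ a,
      Integrable (fun ω => ((W (j * h) ω - W (i * h) ω) a) ^ 2) P := fun i j hij a =>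
    ((hmem i j hij a).mono_exponent (by norm_num)).integrable_sq
  have hmean : ∀ (i j : ℕ), i ≤ j → ∀ a, ∫ ω, (W (j * h) ω - W (i * h) ω) a ∂P = 0 := by
    intro i j hij a
    rw [(hlaw i j hij a).integral_eq, integral_id_gaussianReal]
  have hcast : ∀ (i j : ℕ), i ≤ j → (((j - i : ℕ) * h : ℝ≥0) : ℝ) = (j - i) * h := by
    intro i j hij
    rw [NNReal.coe_mul, NNReal.coe_natCast, Nat.cast_sub hij]
  refine ⟨by unfold wienerConstant; positivity, h.coe_nonneg, fun i => ?_, fun i j hij => ?_,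
    hmemV, hmean, fun i j hij => ?_, fun i j hij => ?_⟩
  · exact (hW.adapted (i * h)).stronglyMeasurable
  · exact hW.indep_increments (i * h) (j * h) (by gcongr)
  · simp only [EuclideanSpace.real_norm_sq_eq]
    rw [integral_finsetSum _ fun a _ => hint2 i j hij a]
    have : ∀ a, ∫ ω, ((W (j * h) ω - W (i * h) ω) a) ^ 2 ∂P = (j - i) * h := by
      intro a
      rw [← hcast i j hij, ← variance_id_gaussianReal (μ := 0) (v := ((j - i : ℕ) * h)),
        ← (hlaw i j hij a).variance_eq, variance_of_integral_eq_zero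
          (hlaw i j hij a).aemeasurable (hmean i j hij a)]
    simp only [this, Finset.sum_const, Finset.card_univ, Fintype.card_fin, nsmul_eq_mul]
    have h0 : (0 : ℝ) ≤ (j - i) * h := by rw [← hcast i j hij]; exact NNReal.coe_nonneg _
    refine mul_le_mul_of_nonneg_right ?_ h0
    unfold wienerConstant
    have : 0 ≤ (m : ℝ) ^ 2 * gaussianFourthMoment := by positivity
    linarith
  · have hpt : ∀ ω, ‖W (j * h) ω - W (i * h) ω‖ ^ 4 ≤
        m * ∑ a, ((W (j * h) ω - W (i * h) ω) a) ^ 4 := by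
      intro ω
      -- Cauchy–Schwarz over the `m` coordinates reduces the fourth moment to one-dimensional
      -- Gaussians; hence the `m ^ 2` in `wienerConstant`.
      have h1 := sq_sum_le_card_mul_sum_sq (s := Finset.univ)
        (f := fun a => ((W (j * h) ω - W (i * h) ω) a) ^ 2)
      rw [← EuclideanSpace.real_norm_sq_eq, Finset.card_univ, Fintype.card_fin] at h1
      simpa only [← pow_mul] using h1
    have hint : Integrable (fun ω => m * ∑ a, ((W (j * h) ω - W (i * h) ω) a) ^ 4) P :=
      (integrable_finsetSum _ fun a _ => hint4 i j hij a).const_mul _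
    refine (integral_mono ((hmemV i j hij).integrable_norm_pow (p := 4) (by norm_num))
      hint hpt).trans ?_
    rw [integral_const_mul, integral_finsetSum _ fun a _ => hint4 i j hij a]
    have : ∀ a, ∫ ω, ((W (j * h) ω - W (i * h) ω) a) ^ 4 ∂P =
        ((j - i) * h) ^ 2 * gaussianFourthMoment := by
      intro a
      rw [← hcast i j hij, ← integral_pow_four_gaussianReal]
      exact (hlaw i j hij a).integral_comp (f := fun x => x ^ 4) (by fun_prop)
    simp only [this, Finset.sum_const, Finset.card_univ, Fintype.card_fin, nsmul_eq_mul]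
    unfold wienerConstant
    have : 0 ≤ (m : ℝ) * ((j - i) * h) ^ 2 := by positivity
    linarith

end Brownian

/-! ### Path independence of the noise-free scheme and continuity of the diffusion. -/

section Scheme

variable {E V : Type*} [NormedAddCommGroup E] [NormedSpace ℝ E] [NormedAddCommGroup V]
  [NormedSpace ℝ V] {Λ : ℝ} {μ : E → E} {σ : E → V →L[ℝ] E}

theorem blockEuler_zero_noise_eq {h : ℝ} {x₀ : E} {M : ℕ} (U U' : ℕ → V) :
    blockEuler μ σ 0 h x₀ M U = blockEuler μ σ 0 h x₀ M U' := by
  ext n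
  induction n using Nat.strong_induction_on with
  | _ n ih =>
    cases n with
    | zero => rw [blockEuler_zero, blockEuler_zero]
    | succ n =>
      rw [blockEuler_succ, blockEuler_succ, ih n n.lt_succ_self,
        ih _ (Nat.lt_succ_of_le (Nat.div_mul_le_self n M)), zero_smul, zero_smul]

theorem CoefficientBounds.continuous_diffusion (hc : CoefficientBounds Λ μ σ) :
    Continuous σ := by
  refine (LipschitzWith.of_dist_le_mul (K := Λ.toNNReal) fun x y => ?_).continuous
  rw [dist_eq_norm, dist_eq_norm, Real.coe_toNNReal _ hc.nonneg]
  exact hc.diffusion_lip x y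

end Scheme

/-! ### Mean square estimates along the schemes. -/

section Moments

variable {Ω : Type*} {mΩ : MeasurableSpace Ω} {m : ℕ} {P : Measure Ω} [IsProbabilityMeasure P]
  {G : Filtration ℕ mΩ} {c h : ℝ} {U : ℕ → Ω → EuclideanSpace ℝ (Fin m)}
  {E : Type*} [NormedAddCommGroup E] [InnerProductSpace ℝ E] {Λ T ε : ℝ} {μ : E → E}
  {σ : E → EuclideanSpace ℝ (Fin m) →L[ℝ] E} {x₀ : E} {M N : ℕ}

theorem CoefficientBounds.memLp_drift (hc : CoefficientBounds Λ μ σ) {X : Ω → E}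
    (hX : MemLp X 2 P) : MemLp (fun ω => μ (X ω)) 2 P :=
  (((memLp_const (1 : ℝ)).add hX.norm).const_mul Λ).mono'
    (hc.differentiable.continuous.comp_aestronglyMeasurable hX.aestronglyMeasurable)
    (ae_of_all _ fun ω => hc.drift_growth (X ω))

theorem CoefficientBounds.memLp_diffusion (hc : CoefficientBounds Λ μ σ) {X : Ω → E}
    (hX : MemLp X 2 P) : MemLp (fun ω => σ (X ω)) 2 P :=
  (((memLp_const (1 : ℝ)).add hX.norm).const_mul Λ).mono'
    (hc.continuous_diffusion.comp_aestronglyMeasurable hX.aestronglyMeasurable)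
    (ae_of_all _ fun ω => hc.diffusion_growth (X ω))

theorem IsDiffusiveNoise.blockEuler_regular (hU : IsDiffusiveNoise P G c h U)
    (hc : CoefficientBounds Λ μ σ) (ε : ℝ) (x₀ : E) (M n : ℕ) :
    StronglyMeasurable[G n] (fun ω => blockEuler μ σ ε h x₀ M (fun i => U i ω) n) ∧
      MemLp (fun ω => blockEuler μ σ ε h x₀ M (fun i => U i ω) n) 2 P := by
  induction n using Nat.strong_induction_on with
  | _ n ih =>
    cases n with
    | zero =>
      simp only [blockEuler_zero]
      exact ⟨stronglyMeasurable_const, memLp_const _⟩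
    | succ n =>
      have hη := Nat.div_mul_le_self n M
      obtain ⟨h1, h2⟩ := ih n n.lt_succ_self
      obtain ⟨h3, h4⟩ := ih _ (Nat.lt_succ_of_le hη)
      have h5 := h3.mono (G.mono hη)
      have hσ : StronglyMeasurable[G n]
          (fun ω => σ (blockEuler μ σ ε h x₀ M (fun i => U i ω) (n / M * M))) :=
        hc.continuous_diffusion.comp_stronglyMeasurable h5
      simp only [blockEuler_succ]
      refine ⟨((h1.mono (G.mono n.le_succ)).add (StronglyMeasurable.const_smul
        (hc.differentiable.continuous.comp_stronglyMeasurable (h5.mono (G.mono n.le_succ))) h)).add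
        (StronglyMeasurable.const_smul (hU.stronglyMeasurable_apply n.le_succ hσ) ε), ?_⟩
      exact (h2.add ((hc.memLp_drift h4).const_smul h)).add
        ((hU.memLp_apply n.le_succ hσ (hc.memLp_diffusion h4)).1.const_smul ε)

/-- The constant in the bound for the mean square deviation of the Euler scheme from its
noise-free counterpart. -/
def deviationConstant (Λ T r c : ℝ) : ℝ :=
  4 * c * T * noiseFreeSpeed Λ T r ^ 2 * Real.exp ((2 * T * Λ ^ 2 + 4 * c * Λ ^ 2) * T)

/-- The difference from the noise-free scheme has a Lipschitz drift and a diffusion of at most a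
constant plus a multiple of the deviation; the energy estimate and the delayed Gronwall inequality
apply. -/
theorem IsDiffusiveNoise.deviation_le (hU : IsDiffusiveNoise P G c h U)
    (hc : CoefficientBounds Λ μ σ) (hε : 0 ≤ ε) (hε1 : ε ≤ 1) (hT : N * h ≤ T) :
    ∀ n ≤ N, ∫ ω, ‖blockEuler μ σ ε h x₀ M (fun i => U i ω) n
      - blockEuler μ σ 0 h x₀ M 0 n‖ ^ 2 ∂P ≤ deviationConstant Λ T ‖x₀‖ c * ε ^ 2 := by
  have hΛ := hc.nonneg
  have hh := hU.step_nonneg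
  have hc0 := hU.const_nonneg
  have hT0 : 0 ≤ T := le_trans (by positivity) hT
  set ρ := noiseFreeSpeed Λ T ‖x₀‖ with hρ
  have hρ0 : 0 ≤ ρ := noiseFreeSpeed_nonneg hΛ hT0 (norm_nonneg _)
  set w := blockEuler μ σ 0 h x₀ M 0 with hw
  set Y : ℕ → Ω → E := fun n ω => blockEuler μ σ ε h x₀ M (fun i => U i ω) n with hY
  have hreg : ∀ n, StronglyMeasurable[G n] (Y n) ∧ MemLp (Y n) 2 P := fun n =>
    hU.blockEuler_regular hc ε x₀ M n
  have hB : ∀ n, MemLp (fun ω => Y n ω - w n) 2 P := fun n =>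
    (hreg n).2.sub (memLp_const _)
  have key := discrete_gronwall_exp (κ := fun i => i / M * M) (fun i => Nat.div_mul_le_self i M)
    (u := fun n => ∫ ω, ‖Y n ω - w n‖ ^ 2 ∂P) (α := 4 * c * T * ρ ^ 2 * ε ^ 2)
    (C := 2 * T * Λ ^ 2 + 4 * c * Λ ^ 2) (by positivity) (by positivity) hh hT fun n hn => ?_
  · intro n hn
    refine (key n hn).trans_eq ?_
    unfold deviationConstant; ring
  have hnT : n * h ≤ T := (mul_le_mul_of_nonneg_right (by exact_mod_cast hn) hh).trans hT
  have hsum : ∀ ω, Y n ω - w n =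
      h • ∑ i ∈ Finset.range n, (μ (Y (i / M * M) ω) - μ (w (i / M * M)))
      + ε • ∑ i ∈ Finset.range n, σ (Y (i / M * M) ω) (U (i + 1) ω - U i ω) := by
    intro ω
    simp only [hY, hw]
    have e1 := blockEuler_eq_sum (μ := μ) (σ := σ) (ε := ε) (h := h) (x₀ := x₀) (M := M)
      (U := fun i => U i ω) n
    have e2 := blockEuler_eq_sum (μ := μ) (σ := σ) (ε := 0) (h := h) (x₀ := x₀) (M := M)
      (U := (0 : ℕ → EuclideanSpace ℝ (Fin m))) n
    rw [e1, e2, zero_smul, Finset.sum_sub_distrib, ← Finset.smul_sum, ← Finset.smul_sum, smul_sub]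
    abel
  have hen := hU.energy hnT ε (a := fun i ω => μ (Y (i / M * M) ω) - μ (w (i / M * M)))
    (K := fun i ω => σ (Y (i / M * M) ω))
    (fun i _ => (hc.memLp_drift (hreg _).2).sub (memLp_const _))
    (fun i _ => hc.continuous_diffusion.comp_stronglyMeasurable
      ((hreg _).1.mono (G.mono (Nat.div_mul_le_self i M))))
    (fun i _ => hc.memLp_diffusion (hreg _).2)
  simp only [← hsum] at hen
  have ha : ∀ i ∈ Finset.range n, ∫ ω, ‖μ (Y (i / M * M) ω) - μ (w (i / M * M))‖ ^ 2 ∂P ≤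
      Λ ^ 2 * ∫ ω, ‖Y (i / M * M) ω - w (i / M * M)‖ ^ 2 ∂P := by
    intro i _
    rw [← integral_const_mul]
    refine integral_mono ((hc.memLp_drift (hreg _).2).sub (memLp_const _)).norm.integrable_sq
      ((hB _).norm.integrable_sq.const_mul _) fun ω => ?_
    refine (pow_le_pow_left₀ (norm_nonneg _) (hc.drift_lip _ _) 2).trans_eq (mul_pow _ _ _)
  have hk : ∀ i ∈ Finset.range n, ∫ ω, ‖σ (Y (i / M * M) ω)‖ ^ 2 ∂P ≤
      2 * ρ ^ 2 + 2 * Λ ^ 2 * ∫ ω, ‖Y (i / M * M) ω - w (i / M * M)‖ ^ 2 ∂P := by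
    intro i hi
    have hb := norm_blockEuler_zero_noise_le (x₀ := x₀) (M := M)
      (U := (0 : ℕ → EuclideanSpace ℝ (Fin m))) hc hh hT _
      ((Nat.div_mul_le_self i M).trans ((Finset.mem_range.1 hi).le.trans hn))
    have hσw : ‖σ (w (i / M * M))‖ ≤ ρ :=
      (hc.diffusion_growth _).trans (by rw [hρ]; unfold noiseFreeSpeed; gcongr)
    calc _ ≤ ∫ ω, (2 * ρ ^ 2 + 2 * Λ ^ 2 * ‖Y (i / M * M) ω - w (i / M * M)‖ ^ 2) ∂P := by
          refine integral_mono (hc.memLp_diffusion (hreg _).2).norm.integrable_sq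
            ((integrable_const _).add ((hB _).norm.integrable_sq.const_mul _)) fun ω => ?_
          have h1 : ‖σ (Y (i / M * M) ω)‖ ≤ ρ + Λ * ‖Y (i / M * M) ω - w (i / M * M)‖ := by
            have := norm_le_norm_add_norm_sub' (σ (Y (i / M * M) ω)) (σ (w (i / M * M)))
            linarith [hc.diffusion_lip (Y (i / M * M) ω) (w (i / M * M))]
          refine (pow_le_pow_left₀ (norm_nonneg _) h1 2).trans (add_sq_le.trans_eq ?_)
          ring
      _ = _ := by
          rw [integral_add (integrable_const _) ((hB _).norm.integrable_sq.const_mul _),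
            integral_const_mul (2 * Λ ^ 2)]
          simp
  refine hen.trans ?_
  have hA := Finset.sum_le_sum ha
  have hK := Finset.sum_le_sum hk
  rw [← Finset.mul_sum] at hA
  rw [Finset.sum_add_distrib, ← Finset.mul_sum _ _ (2 * Λ ^ 2), Finset.sum_const,
    Finset.card_range, nsmul_eq_mul] at hK
  set S := ∑ i ∈ Finset.range n, ∫ ω, ‖Y (i / M * M) ω - w (i / M * M)‖ ^ 2 ∂P with hS
  have hS0 : 0 ≤ S := Finset.sum_nonneg fun _ _ => integral_nonneg fun _ => sq_nonneg _
  -- This keeps the Gronwall exponent independent of `ε`.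
  have hε2 : ε ^ 2 ≤ 1 := pow_le_one₀ hε hε1
  calc _ ≤ 2 * T * h * (Λ ^ 2 * S) + 2 * ε ^ 2 * c * h * (n * (2 * ρ ^ 2) + 2 * Λ ^ 2 * S) := by
        gcongr
    _ = 4 * c * (n * h) * ρ ^ 2 * ε ^ 2 + h * (2 * T * Λ ^ 2 + ε ^ 2 * (4 * c * Λ ^ 2)) * S := by
        ring
    _ ≤ 4 * c * T * ρ ^ 2 * ε ^ 2 + h * (2 * T * Λ ^ 2 + 1 * (4 * c * Λ ^ 2)) * S := by gcongr
    _ = _ := by ring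

theorem sq_sum_five_le (p q r s t : ℝ) :
    (p + q + r + s + t) ^ 2 ≤ 5 * (p ^ 2 + q ^ 2 + r ^ 2 + s ^ 2 + t ^ 2) := by
  have := sq_sum_le_card_mul_sum_sq (s := Finset.univ) (f := ![p, q, r, s, t])
  simpa [Fin.sum_univ_succ, add_assoc] using this

theorem sq_sum_six_le (p q r s t v : ℝ) :
    (p + q + r + s + t + v) ^ 2 ≤ 6 * (p ^ 2 + q ^ 2 + r ^ 2 + s ^ 2 + t ^ 2 + v ^ 2) := by
  have := sq_sum_le_card_mul_sum_sq (s := Finset.univ) (f := ![p, q, r, s, t, v])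
  simpa [Fin.sum_univ_succ, add_assoc] using this

/-- Fewer than `M` steps separate `k` from its block start, and `φ`, known at that start, is
independent of the increment. -/
theorem IsDiffusiveNoise.block_moments (hU : IsDiffusiveNoise P G c h U) (hM : 0 < M) (k : ℕ)
    {φ : Ω → ℝ} (hφ : StronglyMeasurable[G (k / M * M)] φ) (hφ2 : MemLp φ 2 P) :
    MemLp (fun ω => φ ω * ‖U k ω - U (k / M * M) ω‖) 2 P ∧
    ∫ ω, (φ ω * ‖U k ω - U (k / M * M) ω‖) ^ 2 ∂P ≤ c * (M * h) * ∫ ω, φ ω ^ 2 ∂P ∧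
    ∫ ω, ‖U k ω - U (k / M * M) ω‖ ^ 2 ∂P ≤ c * (M * h) ∧
    ∫ ω, ‖U k ω - U (k / M * M) ω‖ ^ 4 ∂P ≤ c * (M * h) ^ 2 := by
  have hη := Nat.div_mul_le_self k M
  have hh := hU.step_nonneg
  have hc0 := hU.const_nonneg
  have h0 : (0 : ℝ) ≤ k - (k / M * M : ℕ) := sub_nonneg.2 (by exact_mod_cast hη)
  have hle : ((k : ℝ) - (k / M * M : ℕ)) * h ≤ M * h := by
    refine mul_le_mul_of_nonneg_right ?_ hh
    have h1 := Nat.div_add_mod' k M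
    have h2 := Nat.mod_lt k hM
    rw [sub_le_iff_le_add]
    exact_mod_cast (by omega : k ≤ M + k / M * M)
  obtain ⟨h1, h2⟩ := hU.memLp_mul_norm hη hφ hφ2
  refine ⟨h1, h2.trans ?_, (hU.second _ _ hη).trans ?_, (hU.fourth _ _ hη).trans ?_⟩
  · refine mul_le_mul_of_nonneg_right ?_ (integral_nonneg fun _ => sq_nonneg _)
    gcongr
  · gcongr
  · gcongr

/-- The constant in the mean square bound for the coupled drift difference. -/
def driftConstant (Λ T r c : ℝ) : ℝ :=
  6 * couplingConstant Λ T r ^ 2 *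
    (2 * deviationConstant Λ T r c + c * deviationConstant Λ T r c + 2 * c * T)

/-- The constant in the mean square bound for the coupled diffusion difference. -/
def diffusionConstant (Λ T r c : ℝ) : ℝ :=
  10 * couplingConstant Λ T r ^ 2 *
    (1 + deviationConstant Λ T r c + c * deviationConstant Λ T r c + c)
    + 2 * (Λ * noiseFreeSpeed Λ T r) ^ 2

section IntegralBounds

variable {f g : Ω → ℝ} {A B : ℝ}

omit [IsProbabilityMeasure P] in
theorem integral_add_bound (hf : Integrable f P ∧ ∫ ω, f ω ∂P ≤ A)
    (hg : Integrable g P ∧ ∫ ω, g ω ∂P ≤ B) :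
    Integrable (fun ω => f ω + g ω) P ∧ ∫ ω, (f ω + g ω) ∂P ≤ A + B :=
  ⟨hf.1.add hg.1, (integral_add hf.1 hg.1).trans_le (add_le_add hf.2 hg.2)⟩

omit [IsProbabilityMeasure P] in
theorem integral_const_mul_bound {r : ℝ} (hr : 0 ≤ r) (hf : Integrable f P ∧ ∫ ω, f ω ∂P ≤ A) :
    Integrable (fun ω => r * f ω) P ∧ ∫ ω, r * f ω ∂P ≤ r * A :=
  ⟨hf.1.const_mul r, (integral_const_mul r f).trans_le (mul_le_mul_of_nonneg_left hf.2 hr)⟩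

end IntegralBounds

/-! ### The double difference of the coupled schemes. -/

section Coupled

variable {X Y : ℕ → Ω → E} {z w : ℕ → E}

theorem deviationConstant_nonneg {Λ T r c : ℝ} (hT : 0 ≤ T) (hc : 0 ≤ c) :
    0 ≤ deviationConstant Λ T r c := by
  unfold deviationConstant; positivity

theorem IsDiffusiveNoise.coupled_regular (hU : IsDiffusiveNoise P G c h U)
    (hc : CoefficientBounds Λ μ σ)
    (hX : X = fun n ω => blockEuler μ σ ε h x₀ 1 (fun i => U i ω) n)
    (hY : Y = fun n ω => blockEuler μ σ ε h x₀ M (fun i => U i ω) n) (n : ℕ) :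
    MemLp (fun ω => X n ω - z n - Y n ω + w n) 2 P := by
  subst hX hY
  exact (((hU.blockEuler_regular hc ε x₀ 1 n).2.sub (memLp_const _)).sub
    (hU.blockEuler_regular hc ε x₀ M n).2).add (memLp_const _)

theorem IsDiffusiveNoise.coupled_drift_le (hU : IsDiffusiveNoise P G c h U)
    (hc : CoefficientBounds Λ μ σ) (hM : 0 < M) (hε : 0 ≤ ε) (hε1 : ε ≤ 1) (hT : N * h ≤ T)
    (hMT : M * h ≤ T) (hX : X = fun n ω => blockEuler μ σ ε h x₀ 1 (fun i => U i ω) n)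
    (hY : Y = fun n ω => blockEuler μ σ ε h x₀ M (fun i => U i ω) n)
    (hz : z = blockEuler μ σ 0 h x₀ 1 (0 : ℕ → EuclideanSpace ℝ (Fin m)))
    (hw : w = blockEuler μ σ 0 h x₀ M (0 : ℕ → EuclideanSpace ℝ (Fin m))) {n : ℕ} (hn : n ≤ N) :
    MemLp (fun ω => μ (X n ω) - μ (z n) - μ (Y (n / M * M) ω) + μ (w (n / M * M))
        - ε • fderiv ℝ μ (w (n / M * M)) (σ (w (n / M * M)) (U n ω - U (n / M * M) ω))) 2 P ∧
    ∫ ω, ‖μ (X n ω) - μ (z n) - μ (Y (n / M * M) ω) + μ (w (n / M * M))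
        - ε • fderiv ℝ μ (w (n / M * M)) (σ (w (n / M * M)) (U n ω - U (n / M * M) ω))‖ ^ 2 ∂P ≤
      6 * couplingConstant Λ T ‖x₀‖ ^ 2 * ∫ ω, ‖X n ω - z n - Y n ω + w n‖ ^ 2 ∂P
      + driftConstant Λ T ‖x₀‖ c * ((M * h) ^ 2 * ε ^ 2 + M * h * ε ^ 4) := by
  have hη := Nat.div_mul_le_self n M
  have hh := hU.step_nonneg
  have hc0 := hU.const_nonneg
  have hT0 : 0 ≤ T := le_trans (by positivity) hMT
  have hYr := fun k => hU.blockEuler_regular hc ε x₀ M k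
  have hXr := fun k => hU.blockEuler_regular hc ε x₀ 1 k
  have hdev := hU.deviation_le (x₀ := x₀) (M := M) hc hε hε1 hT
  rw [← hw] at hdev
  have hE := hU.coupled_regular (z := z) (w := w) hc hX hY n
  have hpt := fun ω => hc.norm_coupled_drift_le (U := fun i => U i ω) (x₀ := x₀)
    (X := fun i => X i ω) (Y := fun i => Y i ω) hM hh hε hT hn (by rw [hY])
    (hz.trans (blockEuler_zero_noise_eq _ _)) (hw.trans (blockEuler_zero_noise_eq _ _))
  have hYn : ∀ k, StronglyMeasurable[G k] (Y k) ∧ MemLp (Y k) 2 P := by rw [hY]; exact hYr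
  have hXn : ∀ k, MemLp (X k) 2 P := by rw [hX]; exact fun k => (hXr k).2
  have hdevY : ∀ k ≤ N, ∫ ω, ‖Y k ω - w k‖ ^ 2 ∂P ≤ deviationConstant Λ T ‖x₀‖ c * ε ^ 2 := by
    rw [hY]; exact hdev
  clear hYr hXr hdev hX hY
  have hB : ∀ k, MemLp (fun ω => Y k ω - w k) 2 P := fun k => (hYn k).2.sub (memLp_const (w k))
  have hΔ := hU.memLp_two hη
  have hR : MemLp (fun ω => μ (X n ω) - μ (z n) - μ (Y (n / M * M) ω) + μ (w (n / M * M))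
        - ε • fderiv ℝ μ (w (n / M * M)) (σ (w (n / M * M)) (U n ω - U (n / M * M) ω))) 2 P :=
    ((((hc.memLp_drift (hXn n)).sub (memLp_const _)).sub (hc.memLp_drift (hYn _).2)).add
      (memLp_const _)).sub
      (((fderiv ℝ μ (w (n / M * M)) ∘L σ (w (n / M * M))).comp_memLp' hΔ).const_smul ε)
  refine ⟨hR, ?_⟩
  obtain ⟨hbu, hbu2, hu2, hu4⟩ := hU.block_moments hM n
    (φ := fun ω => ‖Y (n / M * M) ω - w (n / M * M)‖)
    (((hYn _).1.sub stronglyMeasurable_const).norm) (hB _).norm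
  set Γ := couplingConstant Λ T ‖x₀‖
  set CB := deviationConstant Λ T ‖x₀‖ c with hCB
  have hCB0 : 0 ≤ CB := deviationConstant_nonneg hT0 hc0
  have hH : 0 ≤ M * h := by positivity
  unfold driftConstant
  rw [← hCB]
  generalize M * h = H at *
  have hbB := hdevY _ (hη.trans hn)
  have h1 : Integrable (fun ω => ‖X n ω - z n - Y n ω + w n‖ ^ 2) P ∧
      ∫ ω, ‖X n ω - z n - Y n ω + w n‖ ^ 2 ∂P ≤ ∫ ω, ‖X n ω - z n - Y n ω + w n‖ ^ 2 ∂P :=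
    ⟨hE.norm.integrable_sq, le_rfl⟩
  have h2 := integral_const_mul_bound (sq_nonneg H) ⟨(hB n).norm.integrable_sq, hdevY n hn⟩
  have h3 := integral_const_mul_bound (sq_nonneg H) ⟨(hB _).norm.integrable_sq, hbB⟩
  have h4 := integral_const_mul_bound (sq_nonneg ε) ⟨hbu.integrable_sq,
    hbu2.trans (mul_le_mul_of_nonneg_left hbB (by positivity))⟩
  have h5 := integral_const_mul_bound (sq_nonneg (ε * H)) ⟨hΔ.norm.integrable_sq, hu2⟩
  -- The quadratic Taylor remainder is the one place where fourth moments of the noise enter.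
  have h6 := integral_const_mul_bound (sq_nonneg (ε ^ 2))
    ⟨(hU.memLp _ _ hη).integrable_norm_pow (p := 4) (by norm_num), hu4⟩
  have hall := integral_const_mul_bound (by positivity : 0 ≤ 6 * Γ ^ 2)
    (integral_add_bound (integral_add_bound (integral_add_bound (integral_add_bound
      (integral_add_bound h1 h2) h3) h4) h5) h6)
  refine (integral_mono hR.norm.integrable_sq hall.1 fun ω => ?_).trans (hall.2.trans ?_)
  · refine (pow_le_pow_left₀ (norm_nonneg _) (hpt ω) 2).trans ?_
    rw [mul_pow]
    refine (mul_le_mul_of_nonneg_left (sq_sum_six_le _ _ _ _ _ _) (sq_nonneg _)).trans_eq ?_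
    ring
  · set u := ∫ ω, ‖X n ω - z n - Y n ω + w n‖ ^ 2 ∂P
    -- Here and in `e4` a surplus factor `H` is traded for `T`.
    have e3 : (ε * H) ^ 2 * (c * H) ≤ c * T * (H ^ 2 * ε ^ 2) := by
      calc _ = c * ε ^ 2 * (H ^ 2 * H) := by ring
        _ ≤ c * ε ^ 2 * (H ^ 2 * T) := by gcongr
        _ = _ := by ring
    have e4 : (ε ^ 2) ^ 2 * (c * H ^ 2) ≤ c * T * (H * ε ^ 4) := by
      calc _ = c * ε ^ 4 * (H * H) := by ring
        _ ≤ c * ε ^ 4 * (T * H) := by gcongr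
        _ = _ := by ring
    have p1 : 0 ≤ CB * c * (H ^ 2 * ε ^ 2) := by positivity
    have p2 : 0 ≤ CB * (H * ε ^ 4) := by positivity
    have p3 : 0 ≤ c * T * (H ^ 2 * ε ^ 2) := by positivity
    have p4 : 0 ≤ c * T * (H * ε ^ 4) := by positivity
    have : H ^ 2 * (CB * ε ^ 2) + H ^ 2 * (CB * ε ^ 2) + ε ^ 2 * (c * H * (CB * ε ^ 2))
        + (ε * H) ^ 2 * (c * H) + (ε ^ 2) ^ 2 * (c * H ^ 2) ≤
        (2 * CB + c * CB + 2 * c * T) * (H ^ 2 * ε ^ 2 + H * ε ^ 4) := by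
      linarith
    have := mul_le_mul_of_nonneg_left this (by positivity : 0 ≤ 6 * Γ ^ 2)
    linarith

theorem IsDiffusiveNoise.coupled_diffusion_le (hU : IsDiffusiveNoise P G c h U)
    (hc : CoefficientBounds Λ μ σ) (hM : 0 < M) (hε : 0 ≤ ε) (hε1 : ε ≤ 1) (hT : N * h ≤ T)
    (hMT : M * h ≤ T) (hX : X = fun n ω => blockEuler μ σ ε h x₀ 1 (fun i => U i ω) n)
    (hY : Y = fun n ω => blockEuler μ σ ε h x₀ M (fun i => U i ω) n)
    (hz : z = blockEuler μ σ 0 h x₀ 1 (0 : ℕ → EuclideanSpace ℝ (Fin m)))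
    (hw : w = blockEuler μ σ 0 h x₀ M (0 : ℕ → EuclideanSpace ℝ (Fin m))) {n : ℕ} (hn : n ≤ N)
    {r : ℝ} (hr : 0 ≤ r) (hrM : r ≤ M * h) :
    StronglyMeasurable[G n] (fun ω => σ (X n ω) - σ (Y (n / M * M) ω)
      + r • (fderiv ℝ μ (w (n / M * M)) ∘L σ (w (n / M * M)))) ∧
    MemLp (fun ω => σ (X n ω) - σ (Y (n / M * M) ω)
      + r • (fderiv ℝ μ (w (n / M * M)) ∘L σ (w (n / M * M)))) 2 P ∧
    ε ^ 2 * ∫ ω, ‖σ (X n ω) - σ (Y (n / M * M) ω)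
      + r • (fderiv ℝ μ (w (n / M * M)) ∘L σ (w (n / M * M)))‖ ^ 2 ∂P ≤
      10 * couplingConstant Λ T ‖x₀‖ ^ 2 * ∫ ω, ‖X n ω - z n - Y n ω + w n‖ ^ 2 ∂P
      + diffusionConstant Λ T ‖x₀‖ c * ((M * h) ^ 2 * ε ^ 2 + M * h * ε ^ 4) := by
  have hη := Nat.div_mul_le_self n M
  have hh := hU.step_nonneg
  have hc0 := hU.const_nonneg
  have hΛ := hc.nonneg
  have hT0 : 0 ≤ T := le_trans (by positivity) hMT
  have hYr := fun k => hU.blockEuler_regular hc ε x₀ M k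
  have hXr := fun k => hU.blockEuler_regular hc ε x₀ 1 k
  have hdev := hU.deviation_le (x₀ := x₀) (M := M) hc hε hε1 hT
  rw [← hw] at hdev
  have hE := hU.coupled_regular (z := z) (w := w) hc hX hY n
  have hpt := fun ω => hc.norm_coupled_diffusion_le (U := fun i => U i ω) (x₀ := x₀)
    (X := fun i => X i ω) (Y := fun i => Y i ω) hM hh hε hT hn (by rw [hY])
    (hz.trans (blockEuler_zero_noise_eq _ _)) (hw.trans (blockEuler_zero_noise_eq _ _))
  have hYn : ∀ k, StronglyMeasurable[G k] (Y k) ∧ MemLp (Y k) 2 P := by rw [hY]; exact hYr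
  have hXn : ∀ k, StronglyMeasurable[G k] (X k) ∧ MemLp (X k) 2 P := by rw [hX]; exact hXr
  have hdevY : ∀ k ≤ N, ∫ ω, ‖Y k ω - w k‖ ^ 2 ∂P ≤ deviationConstant Λ T ‖x₀‖ c * ε ^ 2 := by
    rw [hY]; exact hdev
  have hwb := norm_blockEuler_zero_noise_le (x₀ := x₀) (M := M)
    (U := (0 : ℕ → EuclideanSpace ℝ (Fin m))) hc hh hT _ (hη.trans hn)
  rw [← hw] at hwb
  clear hYr hXr hdev hX hY
  have hB : ∀ k, MemLp (fun ω => Y k ω - w k) 2 P := fun k => (hYn k).2.sub (memLp_const (w k))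
  have hΔ := hU.memLp_two hη
  have hK : MemLp (fun ω => σ (X n ω) - σ (Y (n / M * M) ω)
      + r • (fderiv ℝ μ (w (n / M * M)) ∘L σ (w (n / M * M)))) 2 P :=
    ((hc.memLp_diffusion (hXn n).2).sub (hc.memLp_diffusion (hYn _).2)).add (memLp_const _)
  refine ⟨((hc.continuous_diffusion.comp_stronglyMeasurable (hXn n).1).sub
    (hc.continuous_diffusion.comp_stronglyMeasurable ((hYn _).1.mono (G.mono hη)))).add
    stronglyMeasurable_const, hK, ?_⟩
  obtain ⟨hbu, hbu2, hu2, -⟩ := hU.block_moments hM n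
    (φ := fun ω => ‖Y (n / M * M) ω - w (n / M * M)‖)
    (((hYn _).1.sub stronglyMeasurable_const).norm) (hB _).norm
  have hρ0 := noiseFreeSpeed_nonneg hΛ hT0 (norm_nonneg x₀)
  have hrD : ‖r • (fderiv ℝ μ (w (n / M * M)) ∘L σ (w (n / M * M)))‖ ≤
      M * h * (Λ * noiseFreeSpeed Λ T ‖x₀‖) := by
    rw [norm_smul, Real.norm_of_nonneg hr]
    have hσw : ‖σ (w (n / M * M))‖ ≤ noiseFreeSpeed Λ T ‖x₀‖ :=
      (hc.diffusion_growth _).trans (by unfold noiseFreeSpeed; gcongr)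
    have := hc.norm_fderiv_le (w (n / M * M))
    have := ContinuousLinearMap.opNorm_comp_le (fderiv ℝ μ (w (n / M * M))) (σ (w (n / M * M)))
    refine mul_le_mul hrM (this.trans ?_) (norm_nonneg _) (by positivity)
    gcongr
  set Γ := couplingConstant Λ T ‖x₀‖
  set CB := deviationConstant Λ T ‖x₀‖ c with hCB
  have hCB0 : 0 ≤ CB := deviationConstant_nonneg hT0 hc0
  have hH : 0 ≤ M * h := by positivity
  unfold diffusionConstant
  rw [← hCB]
  set ρ := noiseFreeSpeed Λ T ‖x₀‖
  generalize M * h = H at *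
  have hbB := hdevY _ (hη.trans hn)
  have h1 : Integrable (fun ω => ‖X n ω - z n - Y n ω + w n‖ ^ 2) P ∧
      ∫ ω, ‖X n ω - z n - Y n ω + w n‖ ^ 2 ∂P ≤ ∫ ω, ‖X n ω - z n - Y n ω + w n‖ ^ 2 ∂P :=
    ⟨hE.norm.integrable_sq, le_rfl⟩
  have hconst : ∀ t : ℝ, Integrable (fun _ : Ω => t) P ∧ ∫ _, t ∂P ≤ t := fun t =>
    ⟨integrable_const t, by simp⟩
  have h3 := integral_const_mul_bound (sq_nonneg H) ⟨(hB _).norm.integrable_sq, hbB⟩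
  have h4 := integral_const_mul_bound (sq_nonneg ε) ⟨hbu.integrable_sq,
    hbu2.trans (mul_le_mul_of_nonneg_left hbB (by positivity))⟩
  have h5 := integral_const_mul_bound (sq_nonneg ε) ⟨hΔ.norm.integrable_sq, hu2⟩
  -- The factor 10 is 2, for splitting off the martingale correction, times 5, for the five pathwise
  -- terms.
  have hall := integral_add_bound (integral_const_mul_bound (by positivity : 0 ≤ 10 * Γ ^ 2)
    (integral_add_bound (integral_add_bound (integral_add_bound
      (integral_add_bound h1 (hconst (H ^ 2))) h3) h4) h5)) (hconst (2 * (H * (Λ * ρ)) ^ 2))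
  refine (mul_le_mul_of_nonneg_left ((integral_mono hK.norm.integrable_sq hall.1
    fun ω => ?_).trans hall.2) (sq_nonneg ε)).trans ?_
  · refine (pow_le_pow_left₀ (norm_nonneg _) ((norm_add_le _ _).trans
      (add_le_add (hpt ω) hrD)) 2).trans (add_sq_le.trans ?_)
    rw [mul_add, mul_pow Γ]
    have := mul_le_mul_of_nonneg_left (sq_sum_five_le ‖X n ω - z n - Y n ω + w n‖ H
      (H * ‖Y (n / M * M) ω - w (n / M * M)‖)
      (ε * ‖Y (n / M * M) ω - w (n / M * M)‖ * ‖U n ω - U (n / M * M) ω‖)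
      (ε * ‖U n ω - U (n / M * M) ω‖)) (by positivity : 0 ≤ 2 * Γ ^ 2)
    linarith
  · set u := ∫ ω, ‖X n ω - z n - Y n ω + w n‖ ^ 2 ∂P
    have hu0 : 0 ≤ u := integral_nonneg fun _ => sq_nonneg _
    have hε2 : ε ^ 2 ≤ 1 := pow_le_one₀ hε hε1
    -- The surplus `ε ^ 2` is dropped wherever a term already has the required order.
    have e1 : ε ^ 2 * u ≤ 1 * u := by gcongr
    have e2 : ε ^ 2 * (H ^ 2 * (CB * ε ^ 2)) ≤ 1 * (H ^ 2 * (CB * ε ^ 2)) := by gcongr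
    have e3 : ε ^ 2 * (ε ^ 2 * (c * H * (CB * ε ^ 2))) ≤ 1 * (ε ^ 2 * (c * H * (CB * ε ^ 2))) := by
      gcongr
    have p1 : 0 ≤ CB * c * (H ^ 2 * ε ^ 2) := by positivity
    have p2 : 0 ≤ CB * (H * ε ^ 4) := by positivity
    have p3 : 0 ≤ c * (H ^ 2 * ε ^ 2) := by positivity
    have p4 : 0 ≤ H * ε ^ 4 := by positivity
    have p5 : 0 ≤ 2 * (Λ * ρ) ^ 2 * (H * ε ^ 4) := by positivity
    have : ε ^ 2 * (u + H ^ 2 + H ^ 2 * (CB * ε ^ 2) + ε ^ 2 * (c * H * (CB * ε ^ 2))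
        + ε ^ 2 * (c * H)) ≤
        u + (1 + CB + c * CB + c) * (H ^ 2 * ε ^ 2 + H * ε ^ 4) := by
      linarith
    have := mul_le_mul_of_nonneg_left this (by positivity : 0 ≤ 10 * Γ ^ 2)
    linarith

/-- The constant in the mean square bound for the coupled Euler schemes. -/
def couplingErrorConstant (Λ T r c : ℝ) : ℝ :=
  (2 * T ^ 2 * driftConstant Λ T r c + 2 * c * T * diffusionConstant Λ T r c)
    * Real.exp ((12 * T * couplingConstant Λ T r ^ 2 + 20 * c * couplingConstant Λ T r ^ 2) * T)

theorem driftConstant_nonneg {Λ T r c : ℝ} (hT : 0 ≤ T) (hc : 0 ≤ c) :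
    0 ≤ driftConstant Λ T r c := by
  have := deviationConstant_nonneg (Λ := Λ) (r := r) hT hc
  unfold driftConstant; positivity

theorem diffusionConstant_nonneg {Λ T r c : ℝ} (hT : 0 ≤ T) (hc : 0 ≤ c) :
    0 ≤ diffusionConstant Λ T r c := by
  have := deviationConstant_nonneg (Λ := Λ) (r := r) hT hc
  unfold diffusionConstant; positivity

theorem couplingErrorConstant_nonneg {Λ T r c : ℝ} (hT : 0 ≤ T) (hc : 0 ≤ c) :
    0 ≤ couplingErrorConstant Λ T r c := by
  have := driftConstant_nonneg (Λ := Λ) (r := r) hT hc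
  have := diffusionConstant_nonneg (Λ := Λ) (r := r) hT hc
  unfold couplingErrorConstant; positivity

theorem IsDiffusiveNoise.coupling_error_le (hU : IsDiffusiveNoise P G c h U)
    (hc : CoefficientBounds Λ μ σ) (hM : 0 < M) (hε : 0 ≤ ε) (hε1 : ε ≤ 1) (hT : N * h ≤ T)
    (hMT : M * h ≤ T) (hX : X = fun n ω => blockEuler μ σ ε h x₀ 1 (fun i => U i ω) n)
    (hY : Y = fun n ω => blockEuler μ σ ε h x₀ M (fun i => U i ω) n)
    (hz : z = blockEuler μ σ 0 h x₀ 1 (0 : ℕ → EuclideanSpace ℝ (Fin m)))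
    (hw : w = blockEuler μ σ 0 h x₀ M (0 : ℕ → EuclideanSpace ℝ (Fin m))) :
    ∀ n ≤ N, ∫ ω, ‖X n ω - z n - Y n ω + w n‖ ^ 2 ∂P ≤
      couplingErrorConstant Λ T ‖x₀‖ c * ((M * h) ^ 2 * ε ^ 2 + M * h * ε ^ 4) := by
  have hh := hU.step_nonneg
  have hc0 := hU.const_nonneg
  have hT0 : 0 ≤ T := le_trans (by positivity) hMT
  have hCR := driftConstant_nonneg (Λ := Λ) (r := ‖x₀‖) hT0 hc0
  have hCK := diffusionConstant_nonneg (Λ := Λ) (r := ‖x₀‖) hT0 hc0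
  have hdrift := fun i (hi : i ≤ N) =>
    hU.coupled_drift_le hc hM hε hε1 hT hMT hX hY hz hw hi
  have hdiff := fun i (hi : i ≤ N) (r : ℝ) (hr : 0 ≤ r) (hrM : r ≤ M * h) =>
    hU.coupled_diffusion_le hc hM hε hε1 hT hMT hX hY hz hw hi hr hrM
  set Γ := couplingConstant Λ T ‖x₀‖ with hΓ
  set CR := driftConstant Λ T ‖x₀‖ c with hCRd
  set CK := diffusionConstant Λ T ‖x₀‖ c with hCKd
  set Q := (M * h) ^ 2 * ε ^ 2 + M * h * ε ^ 4 with hQ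
  have hQ0 : 0 ≤ Q := by positivity
  have key := discrete_gronwall_exp (κ := id) (fun i => le_rfl)
    (u := fun n => ∫ ω, ‖X n ω - z n - Y n ω + w n‖ ^ 2 ∂P)
    (α := (2 * T ^ 2 * CR + 2 * c * T * CK) * Q)
    (C := 12 * T * Γ ^ 2 + 20 * c * Γ ^ 2) (by positivity) (by positivity) hh hT fun n hn => ?_
  · intro n hn
    refine (key n hn).trans_eq ?_
    unfold couplingErrorConstant
    rw [← hΓ, ← hCRd, ← hCKd]
    ring
  have hnT : n * h ≤ T := (mul_le_mul_of_nonneg_right (by exact_mod_cast hn) hh).trans hT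
  have hlt : ∀ i ∈ Finset.range n, i ≤ N := fun i hi => (Finset.mem_range.1 hi).le.trans hn
  have hL0 : ∀ i, 0 ≤ (laterInBlock M n i : ℝ) * h := fun i => by positivity
  -- This bound makes the regrouped linear noise term contribute only `H²ε²`. The weight depends on
  -- the final index `n`, which is why `hdiff` is uniform in `r`.
  have hLM : ∀ i, (laterInBlock M n i : ℝ) * h ≤ M * h := fun i =>
    mul_le_mul_of_nonneg_right (by exact_mod_cast laterInBlock_le hM n i) hh
  have hsum := fun ω => sub_blockEuler_eq_sum (U := fun i => U i ω) (X := fun i => X i ω)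
    (Y := fun i => Y i ω) hM (by rw [hX]) (by rw [hY])
    (hz.trans (blockEuler_zero_noise_eq _ _)) (hw.trans (blockEuler_zero_noise_eq _ _)) n
  have hen := hU.energy hnT ε
    (fun i hi => (hdrift i (hi.le.trans hn)).1)
    (fun i hi => (hdiff i (hi.le.trans hn) _ (hL0 i) (hLM i)).1)
    (fun i hi => (hdiff i (hi.le.trans hn) _ (hL0 i) (hLM i)).2.1)
  simp only [← hsum] at hen
  refine hen.trans ?_
  have hA := Finset.sum_le_sum fun i hi => (hdrift i (hlt i hi)).2
  have hK := Finset.sum_le_sum fun i hi => (hdiff i (hlt i hi) _ (hL0 i) (hLM i)).2.2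
  rw [Finset.sum_add_distrib, ← Finset.mul_sum, Finset.sum_const, Finset.card_range,
    nsmul_eq_mul] at hA hK
  rw [← Finset.mul_sum] at hK
  set S := ∑ i ∈ Finset.range n, ∫ ω, ‖X i ω - z i - Y i ω + w i‖ ^ 2 ∂P with hS
  simp only [id_eq]
  rw [← hS]
  set SK := ∑ i ∈ Finset.range n, ∫ ω, ‖σ (X i ω) - σ (Y (i / M * M) ω) +
    ((laterInBlock M n i : ℝ) * h) • (fderiv ℝ μ (w (i / M * M)) ∘L σ (w (i / M * M)))‖ ^ 2 ∂P
  calc _ ≤ 2 * T * h * (6 * Γ ^ 2 * S + n * (CR * Q))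
        + 2 * c * h * (10 * Γ ^ 2 * S + n * (CK * Q)) := by
        have h1 := mul_le_mul_of_nonneg_left hA (by positivity : 0 ≤ 2 * T * h)
        have h2 := mul_le_mul_of_nonneg_left hK (by positivity : 0 ≤ 2 * c * h)
        linarith
    _ = 2 * T * (n * h) * (CR * Q) + 2 * c * (n * h) * (CK * Q)
        + h * (12 * T * Γ ^ 2 + 20 * c * Γ ^ 2) * S := by ring
    _ ≤ 2 * T * T * (CR * Q) + 2 * c * T * (CK * Q)
        + h * (12 * T * Γ ^ 2 + 20 * c * Γ ^ 2) * S := by gcongr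
    _ = _ := by ring

end Coupled
end Moments

/-! ### Variance of the difference of the functional. -/

section Functional

variable {Ω : Type*} {mΩ : MeasurableSpace Ω} {m : ℕ} {P : Measure Ω} [IsProbabilityMeasure P]
  {G : Filtration ℕ mΩ} {c h : ℝ} {U : ℕ → Ω → EuclideanSpace ℝ (Fin m)}
  {E : Type*} [NormedAddCommGroup E] [InnerProductSpace ℝ E] {Λ T ε : ℝ} {μ : E → E}
  {σ : E → EuclideanSpace ℝ (Fin m) →L[ℝ] E} {x₀ : E} {M N : ℕ}

theorem variance_le_integral_sub_sq {F : Ω → ℝ} (hF : MemLp F 2 P) (k : ℝ) :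
    Var[F; P] ≤ ∫ ω, (F ω - k) ^ 2 ∂P := by
  rw [← variance_sub_const hF.aestronglyMeasurable k]
  exact variance_le_expectation_sq (hF.aestronglyMeasurable.sub aestronglyMeasurable_const)

/-- The constant in the variance bound for a functional with gradient bounded by `L` and Hessian
bounded by `L₂`. -/
def varianceConstant (Λ T r c L L₂ : ℝ) : ℝ :=
  2 * L ^ 2 * couplingErrorConstant Λ T r c
    + 2 * (L₂ * noiseFreeGap Λ T r) ^ 2 * deviationConstant Λ T r c

theorem varianceConstant_nonneg {Λ T r c L L₂ : ℝ} (hT : 0 ≤ T) (hc : 0 ≤ c) :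
    0 ≤ varianceConstant Λ T r c L L₂ := by
  have := couplingErrorConstant_nonneg (Λ := Λ) (r := r) hT hc
  have := deviationConstant_nonneg (Λ := Λ) (r := r) hT hc
  unfold varianceConstant; positivity

theorem IsDiffusiveNoise.variance_functional_le (hU : IsDiffusiveNoise P G c h U)
    (hc : CoefficientBounds Λ μ σ) (hM : 0 < M) (hε : 0 ≤ ε) (hε1 : ε ≤ 1) (hT : N * h ≤ T)
    (hMT : M * h ≤ T) {f : E → ℝ} {L L₂ : ℝ} (hf : Differentiable ℝ f)
    (hL : ∀ x, ‖fderiv ℝ f x‖ ≤ L) (hL₂0 : 0 ≤ L₂)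
    (hL₂ : ∀ x y, ‖fderiv ℝ f x - fderiv ℝ f y‖ ≤ L₂ * ‖x - y‖) {n : ℕ} (hn : n ≤ N) :
    MemLp (fun ω => f (blockEuler μ σ ε h x₀ 1 (fun i => U i ω) n)
      - f (blockEuler μ σ ε h x₀ M (fun i => U i ω) n)) 2 P ∧
    Var[fun ω => f (blockEuler μ σ ε h x₀ 1 (fun i => U i ω) n)
      - f (blockEuler μ σ ε h x₀ M (fun i => U i ω) n); P] ≤
      varianceConstant Λ T ‖x₀‖ c L L₂ * ((M * h) ^ 2 * ε ^ 2 + M * h * ε ^ 4) := by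
  have hh := hU.step_nonneg
  have hc0 := hU.const_nonneg
  have hΛ := hc.nonneg
  have hT0 : 0 ≤ T := le_trans (by positivity) hMT
  obtain ⟨X, hX⟩ : ∃ X : ℕ → Ω → E,
    X = fun n ω => blockEuler μ σ ε h x₀ 1 (fun i => U i ω) n := ⟨_, rfl⟩
  obtain ⟨Y, hY⟩ : ∃ Y : ℕ → Ω → E,
    Y = fun n ω => blockEuler μ σ ε h x₀ M (fun i => U i ω) n := ⟨_, rfl⟩
  obtain ⟨z, hz⟩ : ∃ z : ℕ → E,
    z = blockEuler μ σ 0 h x₀ 1 (0 : ℕ → EuclideanSpace ℝ (Fin m)) := ⟨_, rfl⟩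
  obtain ⟨w, hw⟩ : ∃ w : ℕ → E,
    w = blockEuler μ σ 0 h x₀ M (0 : ℕ → EuclideanSpace ℝ (Fin m)) := ⟨_, rfl⟩
  have herr := hU.coupling_error_le hc hM hε hε1 hT hMT hX hY hz hw n hn
  have hE := hU.coupled_regular (z := z) (w := w) hc hX hY n
  have hdev := hU.deviation_le (x₀ := x₀) (M := M) hc hε hε1 hT n hn
  have hgap := norm_blockEuler_one_sub_le (x₀ := x₀) (U := (0 : ℕ → EuclideanSpace ℝ (Fin m)))
    hc hM hh hT n hn
  have hXr := (hU.blockEuler_regular hc ε x₀ 1 n).2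
  have hYr := (hU.blockEuler_regular hc ε x₀ M n).2
  have hXe : ∀ ω, blockEuler μ σ ε h x₀ 1 (fun i => U i ω) n = X n ω := fun ω => by rw [hX]
  have hYe : ∀ ω, blockEuler μ σ ε h x₀ M (fun i => U i ω) n = Y n ω := fun ω => by rw [hY]
  rw [← hz, ← hw] at hgap
  rw [← hw] at hdev
  simp only [hXe, hYe] at hXr hYr hdev ⊢
  have hB : MemLp (fun ω => Y n ω - w n) 2 P := hYr.sub (memLp_const _)
  have hζ0 := noiseFreeGap_nonneg hΛ hT0 (norm_nonneg x₀)
  set ζ := noiseFreeGap Λ T ‖x₀‖ with hζ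
  have hL0 : 0 ≤ L := (norm_nonneg _).trans (hL 0)
  have hH : 0 ≤ M * h := by positivity
  have hpt : ∀ ω, ‖f (X n ω) - f (Y n ω) - (f (z n) - f (w n))‖ ≤
      L * ‖X n ω - z n - Y n ω + w n‖ + L₂ * ζ * (M * h) * ‖Y n ω - w n‖ := by
    intro ω
    have := norm_four_point_le hf hL hL₂ (X n ω) (Y n ω) (z n) (w n)
    rw [show X n ω - Y n ω - z n + w n = X n ω - z n - Y n ω + w n by abel,
      show f (X n ω) - f (Y n ω) - f (z n) + f (w n) =
        f (X n ω) - f (Y n ω) - (f (z n) - f (w n)) by ring] at this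
    refine this.trans ?_
    rw [mul_assoc L₂ ζ]
    gcongr
  have hbd : MemLp (fun ω => L * ‖X n ω - z n - Y n ω + w n‖
      + L₂ * ζ * (M * h) * ‖Y n ω - w n‖) 2 P :=
    (hE.norm.const_mul L).add (hB.norm.const_mul _)
  have hD : MemLp (fun ω => f (X n ω) - f (Y n ω) - (f (z n) - f (w n))) 2 P :=
    hbd.mono' (((hf.continuous.comp_aestronglyMeasurable hXr.aestronglyMeasurable).sub
      (hf.continuous.comp_aestronglyMeasurable hYr.aestronglyMeasurable)).sub
      aestronglyMeasurable_const) (ae_of_all _ hpt)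
  have hF : MemLp (fun ω => f (X n ω) - f (Y n ω)) 2 P := by
    refine (hD.add (memLp_const (f (z n) - f (w n)))).ae_eq (ae_of_all _ fun ω => ?_)
    simp
  refine ⟨hF, (variance_le_integral_sub_sq hF (f (z n) - f (w n))).trans ?_⟩
  -- The first term carries the coupling error; in the second, `(M * h) ^ 2` comes from the
  -- noise-free gap and `ε ^ 2` from the deviation of the coarse scheme.
  have hall := integral_add_bound
    (integral_const_mul_bound (by positivity : 0 ≤ 2 * L ^ 2) ⟨hE.norm.integrable_sq, herr⟩)
    (integral_const_mul_bound (by positivity : 0 ≤ 2 * (L₂ * ζ * (M * h)) ^ 2)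
      ⟨hB.norm.integrable_sq, hdev⟩)
  refine (integral_mono hD.integrable_sq hall.1 fun ω => ?_).trans (hall.2.trans ?_)
  · have := pow_le_pow_left₀ (norm_nonneg _) (hpt ω) 2
    rw [Real.norm_eq_abs, sq_abs] at this
    refine this.trans (add_sq_le.trans_eq ?_)
    ring
  · have hCB := deviationConstant_nonneg (Λ := Λ) (r := ‖x₀‖) hT0 hc0
    unfold varianceConstant
    rw [← hζ]
    have : 0 ≤ 2 * (L₂ * ζ) ^ 2 * deviationConstant Λ T ‖x₀‖ c * (M * h * ε ^ 4) := by positivity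
    linarith

end Functional

/-! ### Translation of the standing assumptions, and the main theorem. -/

section Assumptions

variable {d m : ℕ}

theorem le_mul_of_sq_le {p q a Λ : ℝ} (hq : 0 ≤ q) (h : p ^ 2 ≤ a * q ^ 2) (ha : 0 ≤ a)
    (hΛ : √a ≤ Λ) : p ≤ Λ * q := by
  have h1 : p ≤ √(a * q ^ 2) := Real.le_sqrt_of_sq_le h
  rw [Real.sqrt_mul ha, Real.sqrt_sq hq] at h1
  exact h1.trans (mul_le_mul_of_nonneg_right hΛ hq)

theorem RunningAssumption.coefficientBounds {a b : ℝ} (ha : 0 ≤ a) (hb : 0 ≤ b)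
    {μ : EuclideanSpace ℝ (Fin d) → EuclideanSpace ℝ (Fin d)}
    {σ : EuclideanSpace ℝ (Fin d) → (EuclideanSpace ℝ (Fin m) →L[ℝ] EuclideanSpace ℝ (Fin d))}
    (hR : RunningAssumption a b μ σ) : CoefficientBounds (1 + √a + √b) μ σ := by
  have hΛa : √a ≤ 1 + √a + √b := by linarith [Real.sqrt_nonneg b]
  have hΛb : √b ≤ 1 + √a + √b := by linarith [Real.sqrt_nonneg a]
  have hgrow : ∀ x : EuclideanSpace ℝ (Fin d), 1 + ‖x‖ ^ 2 ≤ (1 + ‖x‖) ^ 2 := fun x => by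
    nlinarith [norm_nonneg x]
  refine ⟨by linarith [Real.sqrt_nonneg a, Real.sqrt_nonneg b], hR.differentiable,
    fun x => (Real.le_sqrt_of_sq_le (hR.norm_fderiv_sq_le x)).trans hΛa,
    norm_sub_le_of_norm_fderiv_le hR.differentiable_fderiv
      fun x => (Real.le_sqrt_of_sq_le (hR.norm_fderiv_fderiv_sq_le x)).trans hΛa,
    fun x y => le_mul_of_sq_le (norm_nonneg _) (hR.drift_lipschitz x y) ha hΛa,
    fun x y => le_mul_of_sq_le (norm_nonneg _) (hR.diffusion_lipschitz x y) hb hΛb,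
    fun x => le_mul_of_sq_le (by positivity) ((hR.drift_growth x).trans ?_) ha hΛa,
    fun x => le_mul_of_sq_le (by positivity) ((hR.diffusion_growth x).trans ?_) hb hΛb⟩
  · exact mul_le_mul_of_nonneg_left (hgrow x) ha
  · exact mul_le_mul_of_nonneg_left (hgrow x) hb

/-- Since `F` is arbitrary, a second application, with `F` a space of functionals, passes from
second partial derivatives to the Hessian. -/
theorem norm_le_of_norm_apply_single_le {F : Type*} [NormedAddCommGroup F] [NormedSpace ℝ F]
    {A : EuclideanSpace ℝ (Fin d) →L[ℝ] F} {C : ℝ} (hC : 0 ≤ C)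
    (h : ∀ i, ‖A (EuclideanSpace.single i 1)‖ ≤ C) : ‖A‖ ≤ d * C := by
  refine A.opNorm_le_bound (by positivity) fun v => ?_
  have hv : v = ∑ i, v i • EuclideanSpace.single i (1 : ℝ) := by
    have := (EuclideanSpace.basisFun (Fin d) ℝ).sum_repr v
    simpa using this.symm
  conv_lhs => rw [hv, map_sum]
  have hi : ∀ i ∈ Finset.univ, ‖A (v i • EuclideanSpace.single i (1 : ℝ))‖ ≤ ‖v‖ * C := by
    intro i _
    rw [map_smul, norm_smul]
    exact mul_le_mul (PiLp.norm_apply_le v i) (h i) (norm_nonneg _) (norm_nonneg _)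
  refine (norm_sum_le_of_le _ hi).trans_eq ?_
  simp
  ring

theorem stepSize_pred {T : ℝ≥0} {M ℓ : ℕ} (hM : M ≠ 0) (hℓ : 1 ≤ ℓ) :
    stepSize T M (ℓ - 1) = M * stepSize T M ℓ := by
  obtain ⟨k, rfl⟩ : ∃ k, ℓ = k + 1 := ⟨ℓ - 1, by omega⟩
  have : (M : ℝ≥0) ≠ 0 := by exact_mod_cast hM
  simp only [stepSize, Nat.add_sub_cancel]
  field_simp
  ring

end Assumptions

end SmallNoise

end

theorem theorem1 (a b : ℝ) (ha : 0 < a) (hb : 0 < b) (d m : ℕ) (T : ℝ≥0) (hT : 0 < T)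
    (x₀ : EuclideanSpace ℝ (Fin d)) (C_L : ℝ) :
    ∃ C₁ C₂ : ℝ, 0 < C₁ ∧ 0 < C₂ ∧
      ∀ (μ : EuclideanSpace ℝ (Fin d) → EuclideanSpace ℝ (Fin d))
        (σ : EuclideanSpace ℝ (Fin d) →
          (EuclideanSpace ℝ (Fin m) →L[ℝ] EuclideanSpace ℝ (Fin d)))
        (_ : SmallNoise.RunningAssumption a b μ σ)
        (f : EuclideanSpace ℝ (Fin d) → ℝ) (_ : SmallNoise.BoundedPartials C_L f)
        (ε : ℝ) (_ : 0 < ε) (_ : ε < 1) (M : ℕ) (_ : 2 ≤ M) (ℓ : ℕ) (_ : 1 ≤ ℓ)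
        (Ω : Type*) (mΩ : MeasurableSpace Ω) (P : Measure Ω) (_ : IsProbabilityMeasure P)
        (𝓕 : Filtration ℝ≥0 mΩ) (W : ℝ≥0 → Ω → EuclideanSpace ℝ (Fin m))
        (_ : SmallNoise.IsWienerProcess P 𝓕 W)
        (Dfine Dcoarse : ℝ≥0 → Ω → EuclideanSpace ℝ (Fin d))
        (_ : SmallNoise.IsEulerMaruyama P μ σ ε x₀ W (SmallNoise.stepSize T M ℓ) Dfine)
        (_ : SmallNoise.IsEulerMaruyama P μ σ ε x₀ W (SmallNoise.stepSize T M (ℓ - 1)) Dcoarse),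
        ∀ n : ℕ, n ≤ M ^ (ℓ - 1) →
          MemLp (fun ω => f (Dfine (n * SmallNoise.stepSize T M (ℓ - 1)) ω)
              - f (Dcoarse (n * SmallNoise.stepSize T M (ℓ - 1)) ω)) 2 P ∧
          Var[fun ω => f (Dfine (n * SmallNoise.stepSize T M (ℓ - 1)) ω)
              - f (Dcoarse (n * SmallNoise.stepSize T M (ℓ - 1)) ω); P]
            ≤ C₁ * (SmallNoise.stepSize T M (ℓ - 1) : ℝ) ^ 2 * ε ^ 2
              + C₂ * (SmallNoise.stepSize T M (ℓ - 1) : ℝ) * ε ^ 4 := by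
  have hT0 : (0 : ℝ) ≤ T := T.coe_nonneg
  have hcW : 0 ≤ SmallNoise.wienerConstant m := by
    have := SmallNoise.gaussianFourthMoment_nonneg
    unfold SmallNoise.wienerConstant; positivity
  -- The sign of `C_L` is not prescribed, hence the absolute value.
  set L := (d : ℝ) * |C_L| with hLdef
  set C := SmallNoise.varianceConstant (1 + √a + √b) T ‖x₀‖ (SmallNoise.wienerConstant m) L
    (d * L) with hCdef
  have hC0 : 0 ≤ C := SmallNoise.varianceConstant_nonneg hT0 hcW
  -- One constant serves both terms; adding 1 makes it strictly positive.
  refine ⟨C + 1, C + 1, by positivity, by positivity, ?_⟩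
  intro μ σ hR f hf ε hε hε1 M hM ℓ hℓ Ω mΩ P hP 𝓕 W hW Dfine Dcoarse hDf hDc n hn
  have hM0 : M ≠ 0 := by omega
  have hMpos : (0 : ℝ≥0) < M := by exact_mod_cast hM0.bot_lt
  set h := SmallNoise.stepSize T M ℓ with hh
  have hpred := SmallNoise.stepSize_pred (T := T) hM0 hℓ
  rw [← hh] at hpred
  have hhpos : 0 < h := by rw [hh, SmallNoise.stepSize]; positivity
  have hN : ((M ^ ℓ : ℕ) : ℝ) * h = T := by
    have : ((M ^ ℓ : ℕ) : ℝ≥0) * h = T := by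
      rw [hh, SmallNoise.stepSize]
      push_cast
      field_simp
    exact_mod_cast this
  have hMT : (M : ℝ) * h ≤ T := by
    rw [← hN]
    have : M ≤ M ^ ℓ := Nat.le_self_pow (by omega) M
    gcongr
  have hnM : n * M ≤ M ^ ℓ := by
    calc n * M ≤ M ^ (ℓ - 1) * M := Nat.mul_le_mul_right M hn
      _ = M ^ ℓ := by rw [← pow_succ]; congr 1; omega
  rw [hpred] at hDc ⊢
  -- The coarse grid point `t_n` has index `n * M` on the fine grid.
  have hgrid : (n : ℝ≥0) * (M * h) = ((n * M : ℕ) : ℝ≥0) * h := by push_cast; ring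
  rw [hgrid]
  -- The fine scheme is the case of blocks of length 1.
  have hfine := SmallNoise.IsEulerMaruyama.ae_eq_blockEuler hhpos one_pos
    (by rwa [Nat.cast_one, one_mul] : SmallNoise.IsEulerMaruyama P μ σ ε x₀ W ((1 : ℕ) * h) Dfine)
  have hcoarse := SmallNoise.IsEulerMaruyama.ae_eq_blockEuler hhpos hM0.bot_lt hDc
  have hL : ∀ x, ‖fderiv ℝ f x‖ ≤ L := fun x =>
    SmallNoise.norm_le_of_norm_apply_single_le (abs_nonneg _)
      fun i => (hf.first i x).trans (le_abs_self _)
  have hL₂ : ∀ x, ‖fderiv ℝ (fderiv ℝ f) x‖ ≤ d * L := fun x =>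
    SmallNoise.norm_le_of_norm_apply_single_le (by positivity) fun i =>
      SmallNoise.norm_le_of_norm_apply_single_le (abs_nonneg _)
        fun j => (hf.second i j x).trans (le_abs_self _)
  have hdf : Differentiable ℝ f := hf.contDiff.differentiable (by norm_num)
  have hdf' : Differentiable ℝ (fderiv ℝ f) :=
    (hf.contDiff.fderiv_right (m := 1) (by norm_num)).differentiable (by norm_num)
  obtain ⟨hmem, hvar⟩ := (hW.isDiffusiveNoise h).variance_functional_le (x₀ := x₀)
    (hR.coefficientBounds ha.le hb.le) hM0.bot_lt hε.le hε1.le hN.le hMT hdf hL (by positivity)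
    (SmallNoise.norm_sub_le_of_norm_fderiv_le hdf' hL₂) hnM
  have hae : (fun ω => f (SmallNoise.blockEuler μ σ ε h x₀ 1 (fun i => W (i * h) ω) (n * M))
      - f (SmallNoise.blockEuler μ σ ε h x₀ M (fun i => W (i * h) ω) (n * M))) =ᵐ[P]
      fun ω => f (Dfine ((n * M : ℕ) * h) ω) - f (Dcoarse ((n * M : ℕ) * h) ω) := by
    filter_upwards [hfine, hcoarse] with ω h1 h2
    rw [h1, h2]
  refine ⟨hmem.ae_eq hae, ?_⟩
  rw [← variance_congr hae]
  refine hvar.trans ?_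
  rw [NNReal.coe_mul, NNReal.coe_natCast]
  have p1 : 0 ≤ ((M : ℝ) * h) ^ 2 * ε ^ 2 := by positivity
  have p2 : 0 ≤ (M : ℝ) * h * ε ^ 4 := by positivity
  linarith
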